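/- Let $\zeta\ge 2$ and $d$ be natural numbers, let $\mathbb S^{\zeta-1}$ be the unit sphere of $\mathbb R^\zeta$ with its surface measure, and let $\mathbb{MS}=\mathbb S^{\zeta-1}\times\dots\times\mathbb S^{\zeta-1}$ ($d$ factors), with the product measure. Write $\mathbf x=(\mathbf x^{(1)},\dots,\mathbf x^{(d)})\in\mathbb{MS}$. Let $\boldsymbol k$ be a multi-dot product kernel on $\mathbb{MS}$ given by a power series with real coefficients $b_{\mathbf n}$, $\mathbf n\in\mathbb N^d$, $$\boldsymbol k(\mathbf x,\mathbf z)=\kappa\big(\langle \mathbf x^{(1)},\mathbf z^{(1)}\rangle,\dots,\langle \mathbf x^{(d)},\mathbf z^{(d)}\rangle\big),\qquad \kappa(\mathbf t)=\sum_{\mathbf n\ge 0} b_{\mathbf n}\,t_1^{n_1}\cdots t_d^{n_d},$$ where the series converges (absolutely) at every $\mathbf t\in[-1,1]^d$. Let $Q_k$ be the Gegenbauer polynomial of degree $k$, orthogonal on $[-1,1]$ with respect to the weight $(1-t^2)^{(\zeta-3)/2}$ and normalized by $Q_k(1)=1$, and put $$\lambda_k(t^n)=\int_{-1}^1 t^nQ_k(t)(1-t^2)^{\frac{\zeta-3}{2}}\,dt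 .$$ (i) If $n-k$ is even and non-negative, then $$\lambda_k(t^n)=\frac{n!}{(n-k)!\,2^{k}}\;\frac{\Gamma\left(\frac{\zeta-1}{2}\right)\Gamma\left(\frac{n-k+1}{2}\right)}{\Gamma\left(\frac{n+k+\zeta}{2}\right)},$$ and $\lambda_k(t^n)=0$ otherwise. (ii) For every $\mathbf k\in\mathbb N^d$ the series $$\lambda_{\mathbf k}:=\left|\mathbb S^{\zeta-2}\right|^d\sum_{\mathbf s\ge 0} b_{\mathbf k+2\mathbf s}\prod_{i=1}^d\lambda_{k_i}\big(t^{k_i+2s_i}\big)$$ converges absolutely, where $|\mathbb S^{\zeta-2}|$ is the surface area of the unit sphere of $\mathbb R^{\zeta-1}$, and $\lambda_{\mathbf k}$ is the eigenvalue of $\boldsymbol k$ at frequency $\mathbf k$: it is the unique real $\mu$ such that $\int_{\mathbb{MS}}\boldsymbol k(\mathbf x,\mathbf z)Y(\mathbf z)\,d\mathbf z=\mu\,Y(\mathbf x)$ for all $\mathbf x\in\mathbb{MS}$ and all products $Y(\mathbf x)=\prod_{i=1}^d Y_i(\mathbf x^{(i)})$ of spherical harmonics $Y_i$ of degree $k_i$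 on $\mathbb S^{\zeta-1}$. (iii) The real eigenvalues of the integral operator $f\mapsto\int_{\mathbb{MS}}\boldsymbol k(\cdot,\mathbf z)f(\mathbf z)\,d\mathbf z$ on $L^2(\mathbb{MS})$ are exactly the numbers $\lambda_{\mathbf k}$, $\mathbf k\in\mathbb N^d$. -/

import Mathlib

open MeasureTheory

noncomputable section

namespace MultiDot

/-- The unit sphere `S^{ζ-1}` of `ℝ^ζ`. -/
abbrev Pixel (ζ : ℕ) : Type := Metric.sphere (0 : EuclideanSpace ℝ (Fin ζ)) 1

/-- The multisphere `S^{ζ-1} × ⋯ × S^{ζ-1}` (`d` factors). -/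
abbrev Multisphere (ζ d : ℕ) : Type := Fin d → Pixel ζ

/-- The surface measure of the unit sphere of `ℝ^m`. -/
def surfaceMeasure (m : ℕ) : Measure (Pixel m) :=
  (volume : Measure (EuclideanSpace ℝ (Fin m))).toSphere

/-- The surface area of the unit sphere of `ℝ^m`, that is `|S^{m-1}|`. -/
def sphereArea (m : ℕ) : ℝ := (surfaceMeasure m).real Set.univ

/-- The (unnormalized) uniform measure of the multisphere: the product of the surface measures. -/
def multiMeasure (ζ d : ℕ) : Measure (Multisphere ζ d) :=
  Measure.pi fun _ => surfaceMeasure ζ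

/-- The vector `t ∈ [-1,1]^d` of dot products of corresponding pixels. -/
def pixelDots {ζ d : ℕ} (x z : Multisphere ζ d) : Fin d → ℝ :=
  fun i => inner ℝ (x i : EuclideanSpace ℝ (Fin ζ)) (z i : EuclideanSpace ℝ (Fin ζ))

/-- `K` is the multi-dot product kernel given by the function `κ` of the pixelwise dot products. -/
def IsMultiDotProduct {ζ d : ℕ} (K : Multisphere ζ d → Multisphere ζ d → ℝ)
    (κ : (Fin d → ℝ) → ℝ) : Prop :=
  ∀ x z, K x z = κ (pixelDots x z)

/-- `κ t = ∑_{n ≥ 0} b_n t^n` for every `t` in the hypercube `[-1,1]^d`. -/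
def HasPowerSeriesOnCube {d : ℕ} (κ : (Fin d → ℝ) → ℝ) (b : (Fin d → ℕ) → ℝ) : Prop :=
  ∀ t : Fin d → ℝ, (∀ i, t i ∈ Set.Icc (-1 : ℝ) 1) →
    HasSum (fun n : Fin d → ℕ => b n * ∏ i, t i ^ n i) (κ t)

/-- A spherical harmonic of frequency `k` on `S^{ζ-1}` (possibly zero): the restriction to the
sphere of a homogeneous polynomial of degree `k` whose Laplacian vanishes. -/
def IsSphericalHarmonic {ζ : ℕ} (k : ℕ) (Y : Pixel ζ → ℝ) : Prop :=
  ∃ p : MvPolynomial (Fin ζ) ℝ, p.IsHomogeneous k ∧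
    ∑ i, MvPolynomial.pderiv i (MvPolynomial.pderiv i p) = 0 ∧
    ∀ x : Pixel ζ, Y x = MvPolynomial.eval (fun i => (x : EuclideanSpace ℝ (Fin ζ)) i) p

/-- A product of spherical harmonics, of frequency vector `k`. -/
def IsSHProduct {ζ d : ℕ} (k : Fin d → ℕ) (Y : Multisphere ζ d → ℝ) : Prop :=
  ∃ y : Fin d → Pixel ζ → ℝ, (∀ i, IsSphericalHarmonic (k i) (y i)) ∧
    ∀ x, Y x = ∏ i, y i (x i)

/-- The integral operator with kernel `K`. -/
def kernelOp {ζ d : ℕ} (K : Multisphere ζ d → Multisphere ζ d → ℝ)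
    (f : Multisphere ζ d → ℝ) (x : Multisphere ζ d) : ℝ :=
  ∫ z, K x z * f z ∂(multiMeasure ζ d)

/-- `μ` is the eigenvalue of `K` at frequency `k`: every product of spherical harmonics of
frequency vector `k` satisfies the eigenvalue equation with `μ`. -/
def IsEigenvalueAt {ζ d : ℕ} (K : Multisphere ζ d → Multisphere ζ d → ℝ)
    (k : Fin d → ℕ) (μ : ℝ) : Prop :=
  ∀ Y : Multisphere ζ d → ℝ, IsSHProduct k Y → ∀ x, kernelOp K Y x = μ * Y x

/-- `μ` is an eigenvalue of the integral operator with kernel `K` on `L²` of the multisphere. -/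
def IsKernelEigenvalue {ζ d : ℕ} (K : Multisphere ζ d → Multisphere ζ d → ℝ) (μ : ℝ) : Prop :=
  ∃ f : Multisphere ζ d → ℝ, MemLp f 2 (multiMeasure ζ d) ∧ ¬ f =ᵐ[multiMeasure ζ d] 0 ∧
    ∀ᵐ x ∂(multiMeasure ζ d), kernelOp K f x = μ * f x

/-- The Gegenbauer polynomials `Q_k` of dimension `ζ ≥ 2`, orthogonal on `[-1,1]` with respect to
the weight `(1-t²)^{(ζ-3)/2}` and normalized by `Q_k(1) = 1`, through their three-term recurrence
`(k+ζ-1) Q_{k+2} = (2k+ζ) t Q_{k+1} - (k+1) Q_k`. -/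
def gegenbauer (ζ : ℕ) : ℕ → Polynomial ℝ
  | 0 => 1
  | 1 => Polynomial.X
  | k + 2 =>
      Polynomial.C ((2 * (k : ℝ) + ζ) / ((k : ℝ) + ζ - 1)) * Polynomial.X * gegenbauer ζ (k + 1)
        - Polynomial.C (((k : ℝ) + 1) / ((k : ℝ) + ζ - 1)) * gegenbauer ζ k

/-- `λ_k(t^n) = ∫_{-1}^1 t^n Q_k(t) (1-t²)^{(ζ-3)/2} dt`. -/
def monomialEigenvalue (ζ k n : ℕ) : ℝ :=
  ∫ t in (-1 : ℝ)..1,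
    t ^ n * (gegenbauer ζ k).eval t * (1 - t ^ 2) ^ (((ζ : ℝ) - 3) / 2)

/-- The term of index `s` of the series for the eigenvalue of frequency `k`. -/
def eigenTerm (ζ : ℕ) {d : ℕ} (b : (Fin d → ℕ) → ℝ) (k s : Fin d → ℕ) : ℝ :=
  b (fun i => k i + 2 * s i) * ∏ i, monomialEigenvalue ζ (k i) (k i + 2 * s i)

/-- `|S^{ζ-2}|^d ∑_{s ≥ 0} b_{k+2s} ∏_i λ_{k_i}(t^{k_i+2s_i})`. -/
def seriesEigenvalue (ζ : ℕ) {d : ℕ} (b : (Fin d → ℕ) → ℝ) (k : Fin d → ℕ) : ℝ :=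
  sphereArea (ζ - 1) ^ d * ∑' s : Fin d → ℕ, eigenTerm ζ b k s

end MultiDot

end

/-! Everything rests on the Funk–Hecke formula for a monomial: on one sphere, integrating `⟨x,z⟩^n`
against a harmonic `Y` of degree `k` gives `|S^{ζ-2}| λ_k(t^n) Y(x)`. It is proved without slicing
the sphere. The integrand is the restriction of a homogeneous polynomial, whose Gaussian integral
over `ℝ^ζ` is computed twice: by integration by parts, where harmonicity collapses the recursion to
the value at `x`, and in polar coordinates, where it is the sphere integral times a Gamma factor.
The closed form of `λ_k(t^n)` comes separately, from the moments of the weight and the three-term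
recurrence; comparing constants gives `integral_inner_pow_mul_sphericalHarmonic`.

Since `∑ |b_n|` converges, the kernel may be integrated termwise against a product of harmonics, and
each term factors over the pixels. Only the exponents `k + 2s` survive, so the product is an
eigenfunction with eigenvalue `λ_k` (`kernelOp_eq`). Nonzero harmonics exist in every degree, which
gives uniqueness of the eigenvalue.

There are no other eigenvalues because products of harmonics span a dense subspace of `L²`:
polynomials restrict to sums of harmonics and are dense by Stone–Weierstrass. An eigenfunction `f`
thus has `⟨f,Y⟩ ≠ 0` for some product `Y`, and symmetry of the kernel forces its eigenvalue to be
that of `Y`. Neither compactness of the operator nor the spectral theorem is needed. -/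

namespace MultiDot

/-! ### Moments of the Gegenbauer weight -/

theorem ofReal_betaIntegrand {u v x : ℝ} (hx : x ∈ Set.uIcc (0 : ℝ) 1) :
    ((x : ℂ) ^ ((u : ℂ) - 1) * (1 - (x : ℂ)) ^ ((v : ℂ) - 1)) =
      ((x ^ (u - 1) * (1 - x) ^ (v - 1) : ℝ) : ℂ) := by
  rw [Set.uIcc_of_le zero_le_one] at hx
  rw [Complex.ofReal_mul, Complex.ofReal_cpow hx.1, Complex.ofReal_cpow (by linarith [hx.2])]
  push_cast
  rfl

theorem intervalIntegrable_betaIntegrand {u v : ℝ} (hu : 0 < u) (hv : 0 < v) :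
    IntervalIntegrable (fun x : ℝ => x ^ (u - 1) * (1 - x) ^ (v - 1)) volume 0 1 := by
  have h := Complex.betaIntegral_convergent (u := u) (v := v) (by simpa) (by simpa)
  have h' : IntervalIntegrable (fun x : ℝ => ((x ^ (u - 1) * (1 - x) ^ (v - 1) : ℝ) : ℂ))
      volume 0 1 := h.congr (fun x hx => ofReal_betaIntegrand (Set.uIoc_subset_uIcc hx))
  rw [intervalIntegrable_iff] at h' ⊢
  simpa using! h'.re

theorem integral_betaIntegrand {u v : ℝ} (hu : 0 < u) (hv : 0 < v) :
    ∫ x in (0 : ℝ)..1, x ^ (u - 1) * (1 - x) ^ (v - 1) =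
      Real.Gamma u * Real.Gamma v / Real.Gamma (u + v) := by
  have h := ProbabilityTheory.beta_eq_betaIntegralReal u v hu hv
  rw [ProbabilityTheory.beta] at h
  rw [h, Complex.betaIntegral,
    intervalIntegral.integral_congr (fun x hx => ofReal_betaIntegrand hx),
    intervalIntegral.integral_ofReal, Complex.ofReal_re]

/-- With `u = (t + 1)/2` one has `1 - t² = 4u(1 - u)`, which turns the weight into a Beta integrand.
The exponent `s - 1` corresponds to `s = (ζ - 1)/2`. -/
theorem one_sub_sq_rpow_eq {s t : ℝ} (ht : t ∈ Set.Icc (-1 : ℝ) 1) :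
    (1 - t ^ 2) ^ (s - 1) =
      4 ^ (s - 1) * ((1 / 2 * t + 1 / 2) ^ (s - 1) * (1 - (1 / 2 * t + 1 / 2)) ^ (s - 1)) := by
  have h1 : (0 : ℝ) ≤ 1 / 2 * t + 1 / 2 := by linarith [ht.1]
  have h2 : (0 : ℝ) ≤ 1 - (1 / 2 * t + 1 / 2) := by linarith [ht.2]
  rw [← Real.mul_rpow h1 h2, ← Real.mul_rpow (by norm_num) (mul_nonneg h1 h2)]
  congr 1
  ring

theorem intervalIntegrable_weight {s : ℝ} (hs : 0 < s) :
    IntervalIntegrable (fun t : ℝ => (1 - t ^ 2) ^ (s - 1)) volume (-1) 1 := by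
  have h := (((intervalIntegrable_betaIntegrand hs hs).comp_add_right (1 / 2)).comp_mul_left
    (c := 1 / 2)).const_mul (4 ^ (s - 1))
  norm_num at h
  refine h.congr fun t ht => ?_
  rw [Set.uIoc_of_le (by norm_num)] at ht
  simpa using! (one_sub_sq_rpow_eq (s := s) ⟨ht.1.le, ht.2⟩).symm

theorem integral_weight {s : ℝ} (hs : 0 < s) :
    ∫ t in (-1 : ℝ)..1, (1 - t ^ 2) ^ (s - 1) =
      Real.Gamma s * Real.Gamma (1 / 2) / Real.Gamma (s + 1 / 2) := by
  have h1 : ∫ t in (-1 : ℝ)..1, (1 - t ^ 2) ^ (s - 1) = ∫ t in (-1 : ℝ)..1,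
      4 ^ (s - 1) * ((1 / 2 * t + 1 / 2) ^ (s - 1) * (1 - (1 / 2 * t + 1 / 2)) ^ (s - 1)) := by
    refine intervalIntegral.integral_congr fun t ht => ?_
    rw [Set.uIcc_of_le (by norm_num)] at ht
    exact one_sub_sq_rpow_eq ht
  rw [h1, intervalIntegral.integral_const_mul,
    intervalIntegral.integral_comp_mul_add
      (fun u : ℝ => u ^ (s - 1) * (1 - u) ^ (s - 1)) (by norm_num) (1 / 2)]
  norm_num
  rw [integral_betaIntegrand hs hs, Real.Gamma_one_half_eq]
  -- Legendre duplication converts `Γ(s)²/Γ(2s)` into the stated quotient.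
  have h2 := Real.Gamma_mul_Gamma_add_half s
  have h3 := (Real.Gamma_pos_of_pos hs).ne'
  have h4 := (Real.Gamma_pos_of_pos (show 0 < s + 1 / 2 by linarith)).ne'
  have h5 := (Real.Gamma_pos_of_pos (show 0 < s + s by linarith)).ne'
  have h6 : (4 : ℝ) ^ (s - 1) * 2 * 2 ^ (1 - 2 * s) = 1 := by
    have h7 : (4 : ℝ) ^ (s - 1) = 2 ^ (2 * s - 2) := by
      rw [show (4 : ℝ) = 2 ^ (2 : ℝ) by norm_num, ← Real.rpow_mul (by norm_num)]
      ring_nf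
    have h8 : (2 : ℝ) ^ (2 * s - 2) * 2 ^ (1 - 2 * s) = 1 / 2 := by
      rw [← Real.rpow_add (by norm_num), show 2 * s - 2 + (1 - 2 * s) = -1 by ring,
        Real.rpow_neg_one]
      norm_num
    rw [h7]
    linarith
  rw [← two_mul] at h5 ⊢
  generalize Real.Gamma (s + 1 / 2) = g at *
  generalize Real.Gamma (2 * s) = g' at *
  field_simp
  linear_combination (4 ^ (s - 1) * 2) * h2 + (g' * √Real.pi) * h6

theorem intervalIntegrable_mul_weight {s : ℝ} (hs : 0 < s) {f : ℝ → ℝ} (hf : Continuous f) :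
    IntervalIntegrable (fun t : ℝ => f t * (1 - t ^ 2) ^ (s - 1)) volume (-1) 1 :=
  (intervalIntegrable_weight hs).continuousOn_mul hf.continuousOn

theorem integral_pow_add_two_mul_weight {s : ℝ} (hs : 0 < s) (n : ℕ) :
    (n + 1 + 2 * s) * ∫ t in (-1 : ℝ)..1, t ^ (n + 2) * (1 - t ^ 2) ^ (s - 1) =
      (n + 1) * ∫ t in (-1 : ℝ)..1, t ^ n * (1 - t ^ 2) ^ (s - 1) := by
  have key : ∫ t in (-1 : ℝ)..1, (((n + 1 : ℝ) * t ^ n - (n + 1 + 2 * s) * t ^ (n + 2)) *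
      (1 - t ^ 2) ^ (s - 1)) = 0 := by
    -- The integrand is the derivative of `t^(n+1) (1 - t²)^s`, which vanishes at `±1` because `s >
    -- 0`. Differentiability is needed only in the open interval.
    rw [intervalIntegral.integral_eq_sub_of_hasDerivAt_of_le
      (f := fun t : ℝ => t ^ (n + 1) * (1 - t ^ 2) ^ s) (by norm_num)]
    · simp [Real.zero_rpow hs.ne']
    · exact ((by fun_prop : Continuous fun t : ℝ => t ^ (n + 1)).mul
        ((by fun_prop : Continuous fun t : ℝ => 1 - t ^ 2).rpow_const
          fun _ => Or.inr hs.le)).continuousOn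
    · intro t ht
      have hpos : 0 < 1 - t ^ 2 := by nlinarith [ht.1, ht.2]
      have h1 := (hasDerivAt_pow (n + 1) t).mul
        ((((hasDerivAt_pow 2 t).const_sub 1)).rpow_const (p := s) (Or.inl hpos.ne'))
      convert! h1 using 1
      have : (1 - t ^ 2) ^ s = (1 - t ^ 2) ^ (s - 1) * (1 - t ^ 2) := by
        rw [Real.rpow_sub_one hpos.ne']
        field_simp
      rw [this]
      push_cast
      ring
    · exact intervalIntegrable_mul_weight hs (by fun_prop)
  simp only [sub_mul] at key
  rw [intervalIntegral.integral_sub (intervalIntegrable_mul_weight hs (by fun_prop))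
    (intervalIntegrable_mul_weight hs (by fun_prop))] at key
  simp only [mul_assoc, intervalIntegral.integral_const_mul] at key ⊢
  linarith

theorem integral_pow_even_mul_weight {s : ℝ} (hs : 0 < s) (m : ℕ) :
    ∫ t in (-1 : ℝ)..1, t ^ (2 * m) * (1 - t ^ 2) ^ (s - 1) =
      Real.Gamma s * Real.Gamma (m + 1 / 2) / Real.Gamma (s + m + 1 / 2) := by
  induction m with
  | zero => simpa using integral_weight hs
  | succ m ih =>
    have h := integral_pow_add_two_mul_weight hs (2 * m)
    rw [ih] at h
    push_cast at h ⊢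
    have h4 := (Real.Gamma_pos_of_pos (show 0 < s + m + 1 / 2 by positivity)).ne'
    have h5 : (2 * m + 1 + 2 * s) ≠ 0 := by positivity
    rw [show (m : ℝ) + 1 + 1 / 2 = (m + 1 / 2) + 1 by ring,
      Real.Gamma_add_one (by positivity),
      show s + ((m : ℝ) + 1) + 1 / 2 = (s + m + 1 / 2) + 1 by ring,
      Real.Gamma_add_one (by positivity)]
    refine mul_left_cancel₀ h5 (h.trans ?_)
    field_simp
    ring

theorem integral_pow_odd_mul_weight (s : ℝ) (m : ℕ) :
    ∫ t in (-1 : ℝ)..1, t ^ (2 * m + 1) * (1 - t ^ 2) ^ (s - 1) = 0 := by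
  have h := intervalIntegral.integral_comp_neg (a := -1) (b := 1)
    (fun t : ℝ => t ^ (2 * m + 1) * (1 - t ^ 2) ^ (s - 1))
  simp only [neg_neg, Odd.neg_pow (⟨m, rfl⟩ : Odd (2 * m + 1)), neg_mul, even_two, Even.neg_pow,
    intervalIntegral.integral_neg] at h
  linarith

/-! ### The eigenvalues of monomials -/

theorem monomialEigenvalue_zero (ζ n : ℕ) : monomialEigenvalue ζ 0 n =
    ∫ t in (-1 : ℝ)..1, t ^ n * (1 - t ^ 2) ^ (((ζ : ℝ) - 1) / 2 - 1) := by
  rw [monomialEigenvalue, show ((ζ : ℝ) - 1) / 2 - 1 = ((ζ : ℝ) - 3) / 2 by ring]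
  simp [gegenbauer]

theorem monomialEigenvalue_one (ζ n : ℕ) :
    monomialEigenvalue ζ 1 n = monomialEigenvalue ζ 0 (n + 1) := by
  simp [monomialEigenvalue, gegenbauer, pow_succ]

theorem monomialEigenvalue_add_two {ζ : ℕ} (hζ : 2 ≤ ζ) (k n : ℕ) :
    monomialEigenvalue ζ (k + 2) n =
      (2 * (k : ℝ) + ζ) / ((k : ℝ) + ζ - 1) * monomialEigenvalue ζ (k + 1) (n + 1) -
        ((k : ℝ) + 1) / ((k : ℝ) + ζ - 1) * monomialEigenvalue ζ k n := by
  have hs : (0 : ℝ) < ((ζ : ℝ) - 1) / 2 := by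
    have : (2 : ℝ) ≤ ζ := by exact_mod_cast hζ
    linarith
  have he : ((ζ : ℝ) - 3) / 2 = ((ζ : ℝ) - 1) / 2 - 1 := by ring
  simp only [monomialEigenvalue, he, ← intervalIntegral.integral_const_mul]
  rw [← intervalIntegral.integral_sub]
  · refine intervalIntegral.integral_congr fun t _ => ?_
    simp only [gegenbauer, Polynomial.eval_sub, Polynomial.eval_mul, Polynomial.eval_C,
      Polynomial.eval_X]
    ring
  · exact (intervalIntegrable_mul_weight hs (by fun_prop)).const_mul _
  · exact (intervalIntegrable_mul_weight hs (by fun_prop)).const_mul _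

/-- The recurrence expresses degree `k + 2` through `k + 1` and `k`, so the values and the vanishing
are carried through one two-step induction. -/
theorem monomialEigenvalue_eq_and {ζ : ℕ} (hζ : 2 ≤ ζ) (k : ℕ) :
    (∀ m : ℕ, monomialEigenvalue ζ k (k + 2 * m) =
      ((k + 2 * m).factorial : ℝ) / ((2 * m).factorial * 2 ^ k) *
        (Real.Gamma (((ζ : ℝ) - 1) / 2) * Real.Gamma (m + 1 / 2) /
          Real.Gamma (k + m + (ζ : ℝ) / 2))) ∧
    ∀ n : ℕ, (∀ m, n ≠ k + 2 * m) → monomialEigenvalue ζ k n = 0 := by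
  have h2 : (2 : ℝ) ≤ ζ := by exact_mod_cast hζ
  have hs : (0 : ℝ) < ((ζ : ℝ) - 1) / 2 := by linarith
  have hG : ∀ x : ℝ, 0 < x → Real.Gamma x ≠ 0 := fun x hx => (Real.Gamma_pos_of_pos hx).ne'
  induction k using Nat.twoStepInduction with
  | zero =>
    refine ⟨fun m => ?_, fun n hn => ?_⟩
    · rw [monomialEigenvalue_zero, zero_add, integral_pow_even_mul_weight hs,
        show ((ζ : ℝ) - 1) / 2 + m + 1 / 2 = ((0 : ℕ) : ℝ) + m + ζ / 2 by push_cast; ring]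
      have : ((2 * m).factorial : ℝ) ≠ 0 := by positivity
      field_simp
    · rcases Nat.even_or_odd' n with ⟨m, rfl | rfl⟩
      · exact absurd (zero_add _).symm (hn m)
      · rw [monomialEigenvalue_zero, integral_pow_odd_mul_weight]
  | one =>
    refine ⟨fun m => ?_, fun n hn => ?_⟩
    · rw [monomialEigenvalue_one, monomialEigenvalue_zero,
        show 1 + 2 * m + 1 = 2 * (m + 1) by ring, integral_pow_even_mul_weight hs,
        show ((ζ : ℝ) - 1) / 2 + ((m + 1 : ℕ) : ℝ) + 1 / 2 = ((1 : ℕ) : ℝ) + m + ζ / 2 by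
          push_cast; ring,
        show (((m + 1 : ℕ) : ℝ)) + 1 / 2 = (m + 1 / 2) + 1 by push_cast; ring,
        Real.Gamma_add_one (by positivity), add_comm 1 (2 * m), Nat.factorial_succ]
      have : ((2 * m).factorial : ℝ) ≠ 0 := by positivity
      push_cast
      field_simp
    · rcases Nat.even_or_odd' n with ⟨m, rfl | rfl⟩
      · rw [monomialEigenvalue_one, monomialEigenvalue_zero, integral_pow_odd_mul_weight]
      · exact absurd (add_comm _ _) (hn m)
  | more k ih0 ih1 =>
    have hk : (k : ℝ) + ζ - 1 ≠ 0 := by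
      have : (0 : ℝ) ≤ k := by positivity
      linarith
    refine ⟨fun m => ?_, fun n hn => ?_⟩
    · rw [monomialEigenvalue_add_two hζ,
        show k + 2 + 2 * m + 1 = k + 1 + 2 * (m + 1) by ring, ih1.1,
        show k + 2 + 2 * m = k + 2 * (m + 1) by ring, ih0.1]
      rw [show k + 1 + 2 * (m + 1) = (k + 2 * (m + 1)) + 1 by ring, Nat.factorial_succ,
        show 2 * (m + 1) = 2 * m + 1 + 1 by ring, Nat.factorial_succ (2 * m + 1),
        Nat.factorial_succ (2 * m)]
      push_cast
      rw [show (m : ℝ) + 1 + 1 / 2 = (m + 1 / 2) + 1 by ring, Real.Gamma_add_one (by positivity),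
        show (k : ℝ) + 1 + (m + 1) + ζ / 2 = (k + m + 1 + ζ / 2) + 1 by ring,
        show (k : ℝ) + 2 + m + ζ / 2 = (k + m + 1 + ζ / 2) + 1 by ring,
        show (k : ℝ) + (m + 1) + ζ / 2 = k + m + 1 + ζ / 2 by ring,
        Real.Gamma_add_one (by positivity)]
      have h1 := hG (k + m + 1 + ζ / 2) (by positivity)
      have h3 : ((2 * m).factorial : ℝ) ≠ 0 := by positivity
      have h4 : (k + m + 1 + (ζ : ℝ) / 2) ≠ 0 := by positivity
      field_simp
      ring
    · rw [monomialEigenvalue_add_two hζ]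
      -- The only vanishing case in which the two terms of the recurrence are nonzero: they cancel.
      -- For other `n` each term is zero by induction.
      by_cases hnk : n = k
      · subst hnk
        have e0 := ih0.1 0
        have e1 := ih1.1 0
        simp only [mul_zero, add_zero] at e0 e1
        rw [e0, e1, Nat.factorial_succ]
        push_cast
        rw [show (n : ℝ) + 1 + 0 + ζ / 2 = (n + 0 + ζ / 2) + 1 by ring,
          Real.Gamma_add_one (by positivity)]
        have h1 := hG (n + 0 + ζ / 2) (by positivity)
        have h4 : (n + 0 + (ζ : ℝ) / 2) ≠ 0 := by positivity
        field_simp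
        ring
      · rw [ih1.2, ih0.2]
        · ring
        · intro m hm
          rcases m with _ | m
          · exact hnk hm
          · exact hn m (by omega)
        · intro m hm
          rcases m with _ | m
          · exact hnk (by omega)
          · exact hn m (by omega)

theorem monomialEigenvalue_add {ζ : ℕ} (hζ : 2 ≤ ζ) (k m : ℕ) :
    monomialEigenvalue ζ k (k + 2 * m) =
      ((k + 2 * m).factorial : ℝ) / ((2 * m).factorial * 2 ^ k) *
        (Real.Gamma (((ζ : ℝ) - 1) / 2) * Real.Gamma (m + 1 / 2) /
          Real.Gamma (k + m + (ζ : ℝ) / 2)) :=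
  (monomialEigenvalue_eq_and hζ k).1 m

theorem monomialEigenvalue_eq_zero {ζ : ℕ} (hζ : 2 ≤ ζ) {k n : ℕ} (h : ∀ m, n ≠ k + 2 * m) :
    monomialEigenvalue ζ k n = 0 :=
  (monomialEigenvalue_eq_and hζ k).2 n h

theorem monomialEigenvalue_eq_ite {ζ : ℕ} (hζ : 2 ≤ ζ) (k n : ℕ) :
    monomialEigenvalue ζ k n =
      if k ≤ n ∧ Even (n - k) then
        (n.factorial : ℝ) / (((n - k).factorial : ℝ) * 2 ^ k) *
          (Real.Gamma (((ζ : ℝ) - 1) / 2) * Real.Gamma (((n : ℝ) - k + 1) / 2) /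
            Real.Gamma (((n : ℝ) + k + ζ) / 2))
      else 0 := by
  split_ifs with h
  · obtain ⟨m, hm⟩ := h.2
    obtain rfl : n = k + 2 * m := by omega
    rw [monomialEigenvalue_add hζ, show k + 2 * m - k = 2 * m by omega]
    push_cast
    rw [show ((k : ℝ) + 2 * m - k + 1) / 2 = m + 1 / 2 by ring,
      show ((k : ℝ) + 2 * m + k + ζ) / 2 = k + m + ζ / 2 by ring]
  · refine monomialEigenvalue_eq_zero hζ fun m hm => h ⟨by omega, ⟨m, by omega⟩⟩

end MultiDot

namespace MultiDot

/-! ### Gaussian integrals of polynomials -/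

theorem integrable_pow_mul_gaussian (a : ℕ) :
    Integrable fun t : ℝ => t ^ a * Real.exp (-t ^ 2) := by
  have h := integrable_rpow_mul_exp_neg_mul_sq (b := 1) one_pos (s := a)
    (by linarith [a.cast_nonneg (α := ℝ)])
  simpa using h

/-- Integration by parts against the Gaussian weight. -/
theorem integral_pow_succ_mul_gaussian (a : ℕ) :
    ∫ t : ℝ, t ^ (a + 1) * Real.exp (-t ^ 2) =
      a / 2 * ∫ t : ℝ, t ^ (a - 1) * Real.exp (-t ^ 2) := by
  -- For `a = 0` the truncated exponent `a - 1` is harmless, its coefficient being zero.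
  have h := integral_eq_zero_of_hasDerivAt_of_integrable
    (f := fun t : ℝ => t ^ a * Real.exp (-t ^ 2))
    (f' := fun t => a * (t ^ (a - 1) * Real.exp (-t ^ 2)) -
      2 * (t ^ (a + 1) * Real.exp (-t ^ 2))) (fun t => ?_)
    (((integrable_pow_mul_gaussian _).const_mul _).sub
      ((integrable_pow_mul_gaussian _).const_mul _)) (integrable_pow_mul_gaussian a)
  · rw [integral_sub ((integrable_pow_mul_gaussian _).const_mul _)
      ((integrable_pow_mul_gaussian _).const_mul _), integral_const_mul, integral_const_mul] at h
    linarith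
  · convert! (hasDerivAt_pow a t).mul ((hasDerivAt_pow 2 t).fun_neg.exp) using 1
    push_cast
    ring

variable {ι : Type*} [Fintype ι]

theorem eval_monomial_mul_gaussian (s : ι →₀ ℕ) (c : ℝ) (z : ι → ℝ) :
    MvPolynomial.eval z (MvPolynomial.monomial s c) * Real.exp (-∑ i, z i ^ 2) =
      c * ∏ i, (z i ^ s i * Real.exp (-z i ^ 2)) := by
  rw [MvPolynomial.eval_monomial, Finset.prod_mul_distrib, ← Real.exp_sum,
    Finsupp.prod_fintype _ _ (by simp), Finset.sum_neg_distrib]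
  ring

theorem integrable_eval_mul_gaussian (p : MvPolynomial ι ℝ) :
    Integrable fun z : ι → ℝ => MvPolynomial.eval z p * Real.exp (-∑ i, z i ^ 2) := by
  induction p using MvPolynomial.monomial_add_induction_on with
  | C a =>
    rw [← MvPolynomial.monomial_zero']
    simp only [eval_monomial_mul_gaussian]
    exact (Integrable.fintype_prod fun i => integrable_pow_mul_gaussian _).const_mul _
  | monomial_add s c p _ _ ih =>
    simp only [map_add, add_mul]
    refine Integrable.add ?_ ih
    simp only [eval_monomial_mul_gaussian]
    exact (Integrable.fintype_prod fun i => integrable_pow_mul_gaussian _).const_mul _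

/-- The integral of a polynomial against the Gaussian weight `exp (-|z|²)`. -/
noncomputable def gaussianIntegral : MvPolynomial ι ℝ →ₗ[ℝ] ℝ where
  toFun p := ∫ z : ι → ℝ, MvPolynomial.eval z p * Real.exp (-∑ i, z i ^ 2)
  map_add' p q := by
    simp only [map_add, add_mul]
    exact integral_add (integrable_eval_mul_gaussian p) (integrable_eval_mul_gaussian q)
  map_smul' c p := by
    simp only [MvPolynomial.smul_eval, mul_assoc, integral_const_mul, RingHom.id_apply,
      smul_eq_mul]

theorem gaussianIntegral_apply (p : MvPolynomial ι ℝ) :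
    gaussianIntegral p = ∫ z : ι → ℝ, MvPolynomial.eval z p * Real.exp (-∑ i, z i ^ 2) := rfl

theorem gaussianIntegral_monomial (s : ι →₀ ℕ) (c : ℝ) :
    gaussianIntegral (MvPolynomial.monomial s c) =
      c * ∏ i, ∫ t : ℝ, t ^ s i * Real.exp (-t ^ 2) := by
  rw [gaussianIntegral_apply]
  simp only [eval_monomial_mul_gaussian]
  rw [integral_const_mul,
    integral_fintype_prod_volume_eq_prod (fun i (t : ℝ) => t ^ s i * Real.exp (-t ^ 2))]

theorem gaussianIntegral_C (c : ℝ) :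
    gaussianIntegral (MvPolynomial.C c : MvPolynomial ι ℝ) = c * √Real.pi ^ Fintype.card ι := by
  rw [← MvPolynomial.monomial_zero', gaussianIntegral_monomial]
  have := integral_gaussian 1
  simp at this
  simp [this]

theorem gaussianIntegral_X_mul (i : ι) (p : MvPolynomial ι ℝ) :
    gaussianIntegral (MvPolynomial.X i * p) =
      1 / 2 * gaussianIntegral (MvPolynomial.pderiv i p) := by
  classical
  induction p using MvPolynomial.induction_on' with
  | add p q hp hq => simp only [mul_add, map_add, hp, hq]
  | monomial s c =>
    rw [MvPolynomial.pderiv_monomial, MvPolynomial.X, MvPolynomial.monomial_mul,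
      gaussianIntegral_monomial, gaussianIntegral_monomial,
      ← Finset.mul_prod_erase _ _ (Finset.mem_univ i),
      ← Finset.mul_prod_erase _ (fun j => ∫ t : ℝ, t ^ (s - Finsupp.single i 1 : ι →₀ ℕ) j * _)
        (Finset.mem_univ i)]
    have h : ∏ j ∈ Finset.univ.erase i,
        ∫ t : ℝ, t ^ (Finsupp.single i 1 + s : ι →₀ ℕ) j * Real.exp (-t ^ 2) =
        ∏ j ∈ Finset.univ.erase i,
        ∫ t : ℝ, t ^ (s - Finsupp.single i 1 : ι →₀ ℕ) j * Real.exp (-t ^ 2) := by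
      refine Finset.prod_congr rfl fun j hj => ?_
      have hji : i ≠ j := (Finset.ne_of_mem_erase hj).symm
      simp [Finsupp.single_eq_of_ne' hji]
    rw [h]
    simp only [Finsupp.add_apply, Finsupp.single_eq_same, Finsupp.tsub_apply, add_comm 1 (s i)]
    rw [integral_pow_succ_mul_gaussian]
    ring

/-- The linear form with coefficients `x`, as a polynomial. -/
noncomputable def linearForm (x : ι → ℝ) : MvPolynomial ι ℝ :=
  ∑ i, MvPolynomial.C (x i) * MvPolynomial.X i

/-- The derivative of a polynomial in the direction `x`. -/
noncomputable def dirDeriv (x : ι → ℝ) (q : MvPolynomial ι ℝ) : MvPolynomial ι ℝ :=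
  ∑ i, MvPolynomial.C (x i) * MvPolynomial.pderiv i q

/-- The Laplacian of a polynomial. -/
noncomputable def laplacian : MvPolynomial ι ℝ →ₗ[ℝ] MvPolynomial ι ℝ :=
  ∑ i, (MvPolynomial.pderiv i).toLinearMap ∘ₗ (MvPolynomial.pderiv i).toLinearMap

theorem laplacian_apply (q : MvPolynomial ι ℝ) :
    laplacian q = ∑ i, MvPolynomial.pderiv i (MvPolynomial.pderiv i q) := by
  simp [laplacian]

/-- The commutator of two derivations is a derivation, so it is enough that it kills the variables.
-/
theorem pderiv_comm {σ : Type*} (i j : σ) (q : MvPolynomial σ ℝ) :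
    MvPolynomial.pderiv i (MvPolynomial.pderiv j q) =
      MvPolynomial.pderiv j (MvPolynomial.pderiv i q) := by
  classical
  have h : ⁅(MvPolynomial.pderiv i : Derivation ℝ (MvPolynomial σ ℝ) _),
      (MvPolynomial.pderiv j : Derivation ℝ (MvPolynomial σ ℝ) _)⁆ =
      0 := by
    refine MvPolynomial.derivation_ext fun l => ?_
    simp [Derivation.commutator_apply, MvPolynomial.pderiv_X, Pi.single_apply, apply_ite]
  simpa [Derivation.commutator_apply, sub_eq_zero] using congrArg (fun D => D q) h

theorem laplacian_dirDeriv (x : ι → ℝ) (q : MvPolynomial ι ℝ) :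
    laplacian (dirDeriv x q) = dirDeriv x (laplacian q) := by
  simp only [laplacian_apply, dirDeriv, map_sum, MvPolynomial.C_mul', Derivation.map_smul,
    Finset.smul_sum]
  refine Finset.sum_congr rfl fun j _ => Finset.sum_congr rfl fun i _ => ?_
  rw [pderiv_comm i j q, pderiv_comm i j]

theorem isHomogeneous_dirDeriv {x : ι → ℝ} {q : MvPolynomial ι ℝ} {k : ℕ}
    (hq : q.IsHomogeneous k) : (dirDeriv x q).IsHomogeneous (k - 1) :=
  MvPolynomial.IsHomogeneous.sum _ _ _ fun i _ => hq.pderiv.C_mul (x i)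

theorem eval_dirDeriv_self {x : ι → ℝ} {q : MvPolynomial ι ℝ} {k : ℕ}
    (hq : q.IsHomogeneous k) :
    MvPolynomial.eval x (dirDeriv x q) = k * MvPolynomial.eval x q := by
  have := congrArg (MvPolynomial.eval x) hq.sum_X_mul_pderiv
  simpa [dirDeriv] using this

/-- Split off one linear form and integrate by parts. The derivative of `linearForm x` along `x` is
`|x|² = 1`; at `n = 0` the truncated power carries the factor `0`. -/
theorem gaussianIntegral_linearForm_pow_succ_mul {x : ι → ℝ} (hx : ∑ i, x i ^ 2 = 1) (n : ℕ)
    (q : MvPolynomial ι ℝ) :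
    gaussianIntegral (linearForm x ^ (n + 1) * q) =
      1 / 2 * (n * gaussianIntegral (linearForm x ^ (n - 1) * q) +
        gaussianIntegral (linearForm x ^ n * dirDeriv x q)) := by
  classical
  have hd : ∀ i, MvPolynomial.pderiv i (linearForm x) = MvPolynomial.C (x i) := by
    intro i
    simp [linearForm, MvPolynomial.pderiv_X, Pi.single_apply]
  have h1 : linearForm x ^ (n + 1) * q =
      ∑ i, x i • (MvPolynomial.X i * (linearForm x ^ n * q)) := by
    rw [pow_succ']
    nth_rw 1 [linearForm]
    simp only [Finset.sum_mul, MvPolynomial.C_mul', smul_mul_assoc, mul_assoc]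
  have h2 : ∑ i, x i • MvPolynomial.pderiv i (linearForm x ^ n * q) =
      (n : ℝ) • (linearForm x ^ (n - 1) * q) + linearForm x ^ n * dirDeriv x q := by
    have : ∀ i, x i • MvPolynomial.pderiv i (linearForm x ^ n * q) =
        (x i ^ 2 * n) • (linearForm x ^ (n - 1) * q) +
          linearForm x ^ n * (x i • MvPolynomial.pderiv i q) := by
      intro i
      rw [MvPolynomial.pderiv_mul, Derivation.leibniz_pow, hd]
      simp only [MvPolynomial.smul_eq_C_mul, smul_eq_mul, nsmul_eq_mul, map_mul, map_pow,
        map_natCast]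
      ring
    rw [Finset.sum_congr rfl fun i _ => this i, Finset.sum_add_distrib, ← Finset.sum_smul,
      ← Finset.sum_mul, hx, one_mul, ← Finset.mul_sum, dirDeriv]
    simp only [MvPolynomial.C_mul']
  rw [h1, map_sum]
  simp only [map_smul, gaussianIntegral_X_mul, smul_eq_mul]
  have h3 := congrArg gaussianIntegral h2
  simp only [map_sum, map_smul, map_add, smul_eq_mul] at h3
  rw [← h3, Finset.mul_sum]
  exact Finset.sum_congr rfl fun i _ => by ring

/-- By Euler's identity `k q = ∑ X_i ∂_i q`, and integration by parts makes the right side half the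
integral of the Laplacian. -/
theorem gaussianIntegral_eq_zero_of_harmonic {q : MvPolynomial ι ℝ} {k : ℕ} (hk : k ≠ 0)
    (hq : q.IsHomogeneous k) (hΔ : laplacian q = 0) : gaussianIntegral q = 0 := by
  have h := congrArg gaussianIntegral hq.sum_X_mul_pderiv
  simp only [map_sum, gaussianIntegral_X_mul, map_nsmul] at h
  rw [← Finset.mul_sum, ← map_sum, ← laplacian_apply, hΔ, map_zero, mul_zero] at h
  simpa [hk] using h.symm

theorem dirDeriv_of_isHomogeneous_zero {x : ι → ℝ} {q : MvPolynomial ι ℝ}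
    (hq : q.IsHomogeneous 0) : dirDeriv x q = 0 := by
  rw [← MvPolynomial.totalDegree_zero_iff_isHomogeneous,
    MvPolynomial.totalDegree_eq_zero_iff_eq_C] at hq
  rw [hq]
  simp [dirDeriv]

/-- The recursion lowers `n` by two with `q` fixed, or lowers `n` by one and replaces `q` by
`dirDeriv x q`. The latter is again harmonic, of degree `k - 1`, and takes the value `k q(x)` at
`x`, so only `q(x)` enters the answer. -/
theorem gaussianIntegral_linearForm_pow_mul_harmonic {x : ι → ℝ} (hx : ∑ i, x i ^ 2 = 1) (n : ℕ) :
    ∀ (k : ℕ) (q : MvPolynomial ι ℝ), q.IsHomogeneous k → laplacian q = 0 →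
      (∀ m, n = k + 2 * m → gaussianIntegral (linearForm x ^ n * q) =
        n.factorial / (m.factorial * 2 ^ n) * MvPolynomial.eval x q *
          √Real.pi ^ Fintype.card ι) ∧
      ((∀ m, n ≠ k + 2 * m) → gaussianIntegral (linearForm x ^ n * q) = 0) := by
  induction n using Nat.strong_induction_on with
  | _ n ih =>
  intro k q hq hΔ
  rcases n with _ | n
  · rw [pow_zero, one_mul]
    refine ⟨fun m hm => ?_, fun h => ?_⟩
    · obtain rfl : k = 0 := by omega
      obtain rfl : m = 0 := by omega
      rw [← MvPolynomial.totalDegree_zero_iff_isHomogeneous,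
        MvPolynomial.totalDegree_eq_zero_iff_eq_C] at hq
      rw [hq, gaussianIntegral_C]
      simp
    · refine gaussianIntegral_eq_zero_of_harmonic (fun hk => h 0 (by omega)) hq hΔ
  · rw [gaussianIntegral_linearForm_pow_succ_mul hx]
    have hD : laplacian (dirDeriv x q) = 0 := by
      rw [laplacian_dirDeriv, hΔ]
      simp [dirDeriv]
    have ih1 := ih (n - 1) (by omega) k q hq hΔ
    have ih2 := ih n (by omega) (k - 1) _ (isHomogeneous_dirDeriv (x := x) hq) hD
    rw [eval_dirDeriv_self hq] at ih2
    refine ⟨fun m hm => ?_, fun h => ?_⟩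
    -- The two contributions are `2m` and `k` times the same quantity; `k + 2m = n + 1` then
    -- completes the factorial.
    · have e1 : n * gaussianIntegral (linearForm x ^ (n - 1) * q) =
          2 * m * (n.factorial / (m.factorial * 2 ^ n) * MvPolynomial.eval x q *
            √Real.pi ^ Fintype.card ι) := by
        rcases Nat.eq_zero_or_pos n with rfl | hn
        · obtain rfl : m = 0 := by omega
          simp
        rcases m with _ | m
        · rw [ih1.2 (fun m => by omega)]
          simp
        · rw [ih1.1 m (by omega)]
          obtain ⟨n, rfl⟩ : ∃ n', n = n' + 1 := ⟨n - 1, by omega⟩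
          simp only [Nat.add_sub_cancel, Nat.factorial_succ, pow_succ]
          push_cast
          field_simp
      have e2 : gaussianIntegral (linearForm x ^ n * dirDeriv x q) =
          k * (n.factorial / (m.factorial * 2 ^ n) * MvPolynomial.eval x q *
            √Real.pi ^ Fintype.card ι) := by
        rcases k with _ | k
        · rw [dirDeriv_of_isHomogeneous_zero hq]
          simp
        · rw [ih2.1 m (by omega)]
          ring
      rw [e1, e2, Nat.factorial_succ, pow_succ]
      have e3 : (n : ℝ) + 1 = k + 2 * m := by exact_mod_cast hm
      push_cast
      rw [e3]
      field_simp
      ring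
    · have e1 : n * gaussianIntegral (linearForm x ^ (n - 1) * q) = 0 := by
        rcases Nat.eq_zero_or_pos n with rfl | hn
        · simp
        · rw [ih1.2 (fun m hm => h (m + 1) (by omega)), mul_zero]
      have e2 : gaussianIntegral (linearForm x ^ n * dirDeriv x q) = 0 := by
        rcases k with _ | k
        · rw [dirDeriv_of_isHomogeneous_zero hq]
          simp
        · exact ih2.2 fun m hm => h m (by omega)
      rw [e1, e2]
      simp

/-! ### Polar coordinates -/

/-- Punctured space is the sphere times `(0, ∞)` with density `r^(dim - 1)`. Integrability is not
needed, as the product formula for Bochner integrals holds unconditionally. -/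
theorem integral_eq_integral_toSphere_mul {E : Type*} [NormedAddCommGroup E] [NormedSpace ℝ E]
    [MeasurableSpace E] [BorelSpace E] [FiniteDimensional ℝ E] [Nontrivial E]
    (μ : Measure E) [μ.IsAddHaarMeasure] {F : E → ℝ} {f : Metric.sphere (0 : E) 1 → ℝ}
    {g : ℝ → ℝ} (hF : ∀ (ω : Metric.sphere (0 : E) 1) (r : ℝ), 0 < r → F (r • (ω : E)) = f ω * g r) :
    ∫ z, F z ∂μ = (∫ ω, f ω ∂μ.toSphere) *
      ∫ r in Set.Ioi (0 : ℝ), r ^ (Module.finrank ℝ E - 1) * g r :=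
  calc
    ∫ z, F z ∂μ = ∫ z : ({0}ᶜ : Set E), F z ∂(μ.comap (↑)) := by
      rw [integral_subtype_comap (measurableSet_singleton _).compl F,
        restrict_compl_singleton]
    _ = ∫ y, F ((y.2 : ℝ) • (y.1 : E)) ∂μ.toSphere.prod (.volumeIoiPow (Module.finrank ℝ E - 1)) := by
      rw [← μ.measurePreserving_homeomorphUnitSphereProd.integral_comp
        (Homeomorph.measurableEmbedding _)]
      refine integral_congr_ae (.of_forall fun z => ?_)
      have hz : ‖(z : E)‖ ≠ 0 := norm_ne_zero_iff.mpr z.2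
      simp [smul_smul, hz]
    _ = ∫ y, f y.1 * g (y.2 : ℝ) ∂μ.toSphere.prod (.volumeIoiPow (Module.finrank ℝ E - 1)) :=
      integral_congr_ae (.of_forall fun y => hF y.1 y.2 y.2.2)
    _ = (∫ ω, f ω ∂μ.toSphere) *
        ∫ r : Set.Ioi (0 : ℝ), g r ∂.volumeIoiPow (Module.finrank ℝ E - 1) :=
      integral_prod_mul f (fun r : Set.Ioi (0 : ℝ) => g r)
    _ = _ := by
      congr 1
      simp only [Measure.volumeIoiPow, ENNReal.ofReal]
      rw [integral_withDensity_eq_integral_smul,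
        integral_subtype_comap measurableSet_Ioi
          fun a ↦ Real.toNNReal (a ^ (Module.finrank ℝ E - 1)) • g a,
        setIntegral_congr_fun measurableSet_Ioi fun x hx ↦ ?_]
      · rw [NNReal.smul_def, Real.coe_toNNReal _ (pow_nonneg hx.out.le _), smul_eq_mul]
      · exact (measurable_subtype_coe.pow_const _).real_toNNReal

theorem eval_smul_of_isHomogeneous {σ : Type*} {p : MvPolynomial σ ℝ} {k : ℕ}
    (hp : p.IsHomogeneous k) (r : ℝ) (x : σ → ℝ) :
    MvPolynomial.eval (fun i => r * x i) p = r ^ k * MvPolynomial.eval x p := by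
  rw [MvPolynomial.eval_eq, MvPolynomial.eval_eq, Finset.mul_sum]
  refine Finset.sum_congr rfl fun s hs => ?_
  have := hp.degree_eq_sum_deg_support hs
  simp only [mul_pow, Finset.prod_mul_distrib, Finset.prod_pow_eq_pow_sum]
  rw [this]
  ring

theorem sum_sq_eq_one {ζ : ℕ} (x : Pixel ζ) : ∑ i, (x : EuclideanSpace ℝ (Fin ζ)) i ^ 2 = 1 := by
  rw [← EuclideanSpace.real_norm_sq_eq]
  simp

/-- The radial factor is `∫ r^(N+ζ-1) exp(-r²) dr = Γ((N+ζ)/2)/2`. Being nonzero, it lets sphere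
integrals be read off from Gaussian ones. -/
theorem gaussianIntegral_eq_sphere_integral {ζ : ℕ} (hζ : ζ ≠ 0) {p : MvPolynomial (Fin ζ) ℝ}
    {N : ℕ} (hp : p.IsHomogeneous N) :
    gaussianIntegral p =
      (∫ ω : Pixel ζ, MvPolynomial.eval (fun i => (ω : EuclideanSpace ℝ (Fin ζ)) i) p
        ∂surfaceMeasure ζ) * (Real.Gamma ((N + ζ) / 2) / 2) := by
  have : Nonempty (Fin ζ) := ⟨⟨0, Nat.pos_of_ne_zero hζ⟩⟩
  rw [gaussianIntegral_apply, ← (PiLp.volume_preserving_ofLp (Fin ζ)).integral_comp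
    (MeasurableEquiv.toLp 2 (Fin ζ → ℝ)).symm.measurableEmbedding,
    integral_eq_integral_toSphere_mul (volume : Measure (EuclideanSpace ℝ (Fin ζ)))
      (f := fun ω => MvPolynomial.eval (fun i => (ω : EuclideanSpace ℝ (Fin ζ)) i) p)
      (g := fun r => r ^ N * Real.exp (-r ^ 2))]
  · congr 1
    have h := integral_rpow_mul_exp_neg_rpow (p := 2) (q := (ζ - 1 + N : ℕ)) (by norm_num)
      (by linarith [(ζ - 1 + N).cast_nonneg (α := ℝ)])
    simp only [Real.rpow_natCast, Real.rpow_two] at h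
    rw [finrank_euclideanSpace, Fintype.card_fin]
    simp only [← mul_assoc, ← pow_add]
    rw [h, Nat.cast_add, Nat.cast_sub (by omega)]
    push_cast
    ring_nf
  · intro ω r _
    simp only [PiLp.smul_apply, smul_eq_mul, mul_pow, ← Finset.mul_sum, sum_sq_eq_one,
      mul_one]
    rw [← mul_assoc, mul_comm _ (r ^ N)]
    congr 1
    exact eval_smul_of_isHomogeneous hp r _

theorem sphereArea_eq {m : ℕ} (hm : m ≠ 0) :
    sphereArea m = 2 * √Real.pi ^ m / Real.Gamma (m / 2) := by
  have : Nonempty (Fin m) := ⟨⟨0, Nat.pos_of_ne_zero hm⟩⟩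
  have hm' : (0 : ℝ) < m := by positivity
  rw [sphereArea, surfaceMeasure, Measure.toSphere_real_apply_univ, measureReal_def,
    EuclideanSpace.volume_ball, finrank_euclideanSpace, Fintype.card_fin,
    Real.Gamma_add_one (by positivity)]
  have := Real.Gamma_pos_of_pos (half_pos hm')
  rw [ENNReal.ofReal_one, one_pow, one_mul, ENNReal.toReal_ofReal (by positivity)]
  field_simp

/-! ### The Funk–Hecke formula for monomials -/

theorem eval_linearForm (x y : ι → ℝ) :
    MvPolynomial.eval y (linearForm x) = ∑ i, x i * y i := by
  simp [linearForm]

theorem isHomogeneous_linearForm (x : ι → ℝ) : (linearForm x).IsHomogeneous 1 :=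
  MvPolynomial.IsHomogeneous.sum _ _ _ fun i _ => MvPolynomial.isHomogeneous_C_mul_X (x i) i

theorem Gamma_nat_add_half_eq (m : ℕ) :
    Real.Gamma (m + 1 / 2) = (2 * m).factorial * √Real.pi / (4 ^ m * m.factorial) := by
  induction m with
  | zero => simp [-one_div, Real.Gamma_one_half_eq]
  | succ m ih =>
    rw [Nat.cast_succ, show (m : ℝ) + 1 + 1 / 2 = (m + 1 / 2) + 1 by ring,
      Real.Gamma_add_one (by positivity), ih, show 2 * (m + 1) = 2 * m + 1 + 1 by ring]
    simp only [Nat.factorial_succ, pow_succ]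
    push_cast
    field_simp
    ring

theorem integral_inner_pow_mul_sphericalHarmonic {ζ : ℕ} (hζ : 2 ≤ ζ) {k : ℕ} {Y : Pixel ζ → ℝ}
    (hY : IsSphericalHarmonic k Y) (n : ℕ) (x : Pixel ζ) :
    ∫ z : Pixel ζ, inner ℝ (x : EuclideanSpace ℝ (Fin ζ)) (z : EuclideanSpace ℝ (Fin ζ)) ^ n * Y z
      ∂surfaceMeasure ζ = sphereArea (ζ - 1) * monomialEigenvalue ζ k n * Y x := by
  obtain ⟨q, hq, hΔ, hYq⟩ := hY
  rw [← laplacian_apply] at hΔ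
  have hx := sum_sq_eq_one x
  set x' : Fin ζ → ℝ := fun i => (x : EuclideanSpace ℝ (Fin ζ)) i with hx'
  have hG := gaussianIntegral_linearForm_pow_mul_harmonic hx n k q hq hΔ
  have hP := gaussianIntegral_eq_sphere_integral (show ζ ≠ 0 by omega)
    (((isHomogeneous_linearForm x').pow n).mul hq)
  have hI : ∫ z : Pixel ζ, inner ℝ (x : EuclideanSpace ℝ (Fin ζ))
        (z : EuclideanSpace ℝ (Fin ζ)) ^ n * Y z ∂surfaceMeasure ζ =
      ∫ ω : Pixel ζ, MvPolynomial.eval (fun i => (ω : EuclideanSpace ℝ (Fin ζ)) i)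
        (linearForm x' ^ n * q) ∂surfaceMeasure ζ := by
    refine integral_congr_ae (.of_forall fun z => ?_)
    simp [eval_linearForm, hYq, PiLp.inner_apply, hx', mul_comm]
  rw [hI]
  have h2 : (2 : ℝ) ≤ ζ := by exact_mod_cast hζ
  have hΓ := (Real.Gamma_pos_of_pos (show (0 : ℝ) < (((1 * n + k : ℕ) : ℝ) + ζ) / 2 by positivity)).ne'
  by_cases h : ∃ m, n = k + 2 * m
  · obtain ⟨m, rfl⟩ := h
    have hs : (((ζ - 1 : ℕ) : ℝ) / 2) = ((ζ : ℝ) - 1) / 2 := by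
      rw [Nat.cast_sub (by omega)]
      simp
    have hΓ' := (Real.Gamma_pos_of_pos (show (0 : ℝ) < ((ζ : ℝ) - 1) / 2 by linarith)).ne'
    rw [hG.1 m rfl, Fintype.card_fin] at hP
    rw [monomialEigenvalue_add hζ, sphereArea_eq (by omega), hs, hYq, Gamma_nat_add_half_eq,
      show (k : ℝ) + m + ζ / 2 = (((1 * (k + 2 * m) + k : ℕ) : ℝ) + ζ) / 2 by push_cast; ring]
    -- Of the `ζ` factors `√π`, `ζ - 1` belong to the area of the lower sphere and one to `Γ(m +
    -- 1/2)`.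
    obtain ⟨j, rfl⟩ : ∃ j, ζ = j + 1 := ⟨ζ - 1, by omega⟩
    rw [Nat.add_sub_cancel]
    rw [pow_succ] at hP
    refine mul_right_cancel₀ (div_ne_zero hΓ two_ne_zero) (hP.symm.trans ?_)
    rw [show (2 : ℝ) ^ (k + 2 * m) = 2 ^ k * 4 ^ m by rw [pow_add, pow_mul]; norm_num]
    generalize Real.Gamma ((((1 * (k + 2 * m) + k : ℕ) : ℝ) + (j + 1 : ℕ)) / 2) = g at *
    generalize Real.Gamma ((((j + 1 : ℕ) : ℝ) - 1) / 2) = g' at *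
    field_simp
  · push Not at h
    rw [hG.2 h] at hP
    rw [monomialEigenvalue_eq_zero hζ h]
    have := (mul_eq_zero.mp hP.symm).resolve_right (div_ne_zero hΓ two_ne_zero)
    rw [this]
    simp

end MultiDot

namespace MultiDot

/-! ### Harmonic decomposition of polynomials -/

section Harmonic

open MvPolynomial

variable {ι : Type*} [Fintype ι]

/-- The polynomial `∑ i, X i ^ 2`. -/
noncomputable def normSqPoly (ι : Type*) [Fintype ι] : MvPolynomial ι ℝ := ∑ i, X i ^ 2

theorem isHomogeneous_normSqPoly : (normSqPoly ι).IsHomogeneous 2 :=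
  IsHomogeneous.sum _ _ _ fun i _ => isHomogeneous_X_pow i 2

theorem pderiv_normSqPoly (i : ι) : pderiv i (normSqPoly ι) = 2 * X i := by
  classical
  simp [normSqPoly, Derivation.leibniz_pow, pderiv_X, Pi.single_apply]

theorem isHomogeneous_laplacian {q : MvPolynomial ι ℝ} {k : ℕ} (hq : q.IsHomogeneous k) :
    (laplacian q).IsHomogeneous (k - 1 - 1) := by
  rw [laplacian_apply]
  exact IsHomogeneous.sum _ _ _ fun i _ => hq.pderiv.pderiv

theorem laplacian_normSqPoly_mul {v : MvPolynomial ι ℝ} {k : ℕ} (hv : v.IsHomogeneous k) :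
    laplacian (normSqPoly ι * v) =
      (2 * (Fintype.card ι : ℝ) + 4 * k) • v + normSqPoly ι * laplacian v := by
  have h : ∀ i, pderiv i (pderiv i (normSqPoly ι * v)) =
      2 * v + 4 * (X i * pderiv i v) + normSqPoly ι * pderiv i (pderiv i v) := by
    intro i
    have h2 : pderiv i (2 : MvPolynomial ι ℝ) = 0 := pderiv_C (a := 2)
    simp only [pderiv_mul, pderiv_normSqPoly, map_add, pderiv_X_self, h2]
    ring
  rw [laplacian_apply, Finset.sum_congr rfl fun i _ => h i, Finset.sum_add_distrib,
    Finset.sum_add_distrib, ← Finset.mul_sum, ← Finset.mul_sum,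
    ← Finset.mul_sum, hv.sum_X_mul_pderiv, ← laplacian_apply, Finset.sum_const, Finset.card_univ]
  simp only [nsmul_eq_mul, smul_eq_C_mul, map_add, map_mul, map_natCast, map_ofNat]
  ring

theorem pderiv_eq_zero_of_isHomogeneous_zero {σ : Type*} {q : MvPolynomial σ ℝ}
    (hq : q.IsHomogeneous 0) (i : σ) : pderiv i q = 0 := by
  rw [← totalDegree_zero_iff_isHomogeneous, totalDegree_eq_zero_iff_eq_C] at hq
  rw [hq, pderiv_C]

theorem laplacian_eq_zero_of_lt_two {q : MvPolynomial ι ℝ} {k : ℕ} (hq : q.IsHomogeneous k)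
    (hk : k < 2) : laplacian q = 0 := by
  rw [laplacian_apply]
  refine Finset.sum_eq_zero fun i _ => pderiv_eq_zero_of_isHomogeneous_zero ?_ i
  have := hq.pderiv (i := i)
  rwa [show k - 1 = 0 by omega] at this

/-- Solve the same equation for `laplacian q`, in degree two less and with `c` enlarged by `2 card ι
+ 4k`, to get `v`; then `u = c⁻¹(q - |X|² v)` has Laplacian `v`. This is why `c` is quantified
inside the induction. -/
theorem exists_smul_add_normSqPoly_mul_laplacian_eq (k : ℕ) :
    ∀ (c : ℝ), 0 < c → ∀ q : MvPolynomial ι ℝ, q.IsHomogeneous k →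
      ∃ u : MvPolynomial ι ℝ, u.IsHomogeneous k ∧ c • u + normSqPoly ι * laplacian u = q := by
  have hsmul : ∀ (c : ℝ) {q : MvPolynomial ι ℝ} {k : ℕ}, q.IsHomogeneous k →
      (c • q).IsHomogeneous k := fun c q k hq => by
    rw [smul_eq_C_mul]
    exact hq.C_mul c
  induction k using Nat.twoStepInduction with
  | zero =>
    intro c hc q hq
    refine ⟨c⁻¹ • q, hsmul _ hq, ?_⟩
    rw [map_smul, laplacian_eq_zero_of_lt_two hq (by norm_num), smul_inv_smul₀ hc.ne']
    simp
  | one =>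
    intro c hc q hq
    refine ⟨c⁻¹ • q, hsmul _ hq, ?_⟩
    rw [map_smul, laplacian_eq_zero_of_lt_two hq (by norm_num), smul_inv_smul₀ hc.ne']
    simp
  | more k ih _ =>
    intro c hc q hq
    obtain ⟨v, hv, hvq⟩ := ih (c + (2 * (Fintype.card ι : ℝ) + 4 * k)) (by positivity)
      (laplacian q) (isHomogeneous_laplacian hq)
    refine ⟨c⁻¹ • (q - normSqPoly ι * v), hsmul _ (hq.sub ?_), ?_⟩
    · rw [add_comm]
      exact isHomogeneous_normSqPoly.mul hv
    · rw [map_smul, map_sub, laplacian_normSqPoly_mul hv, ← hvq, smul_inv_smul₀ hc.ne', add_smul,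
        show c • v + (2 * (Fintype.card ι : ℝ) + 4 * k) • v + normSqPoly ι * laplacian v -
          ((2 * (Fintype.card ι : ℝ) + 4 * k) • v + normSqPoly ι * laplacian v) = c • v by abel,
        inv_smul_smul₀ hc.ne']
      ring

/-- The preceding lemma yields `q` with `Δ(|X|² q) = Δp`. `Nonempty ι` keeps the constant positive
when `k = 0`. -/
theorem exists_harmonic_add_normSqPoly_mul [Nonempty ι] {k : ℕ} {p : MvPolynomial ι ℝ}
    (hp : p.IsHomogeneous (k + 2)) :
    ∃ h q : MvPolynomial ι ℝ, h.IsHomogeneous (k + 2) ∧ laplacian h = 0 ∧ q.IsHomogeneous k ∧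
      p = h + normSqPoly ι * q := by
  obtain ⟨q, hq, hpq⟩ := exists_smul_add_normSqPoly_mul_laplacian_eq k
    (2 * (Fintype.card ι : ℝ) + 4 * k) (by positivity) (laplacian p) (isHomogeneous_laplacian hp)
  refine ⟨p - normSqPoly ι * q, q, hp.sub ?_, ?_, hq, by ring⟩
  · rw [add_comm]
    exact isHomogeneous_normSqPoly.mul hq
  · rw [map_sub, laplacian_normSqPoly_mul hq, ← hpq, sub_self]

/-- The spherical harmonics of frequency `k`, as a space of functions. -/
noncomputable def harmonicSpace (ζ k : ℕ) : Submodule ℝ (Pixel ζ → ℝ) where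
  carrier := {Y | IsSphericalHarmonic k Y}
  zero_mem' := ⟨0, isHomogeneous_zero _ _ _, by simp, by simp⟩
  add_mem' := by
    rintro Y Y' ⟨p, hp, hΔ, hY⟩ ⟨p', hp', hΔ', hY'⟩
    exact ⟨p + p', hp.add hp', by simp [Finset.sum_add_distrib, hΔ, hΔ'], by simp [hY, hY']⟩
  smul_mem' := by
    rintro c Y ⟨p, hp, hΔ, hY⟩
    refine ⟨C c * p, hp.C_mul c, ?_, by simp [hY]⟩
    simp only [C_mul', Derivation.map_smul]
    rw [← Finset.smul_sum, hΔ, smul_zero]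

/-- The restriction of a polynomial to the unit sphere. -/
noncomputable def sphereRestrict (ζ : ℕ) : MvPolynomial (Fin ζ) ℝ →ₗ[ℝ] Pixel ζ → ℝ where
  toFun p x := eval (fun i => (x : EuclideanSpace ℝ (Fin ζ)) i) p
  map_add' p q := by ext; simp
  map_smul' c p := by ext; simp

theorem sphereRestrict_apply {ζ : ℕ} (p : MvPolynomial (Fin ζ) ℝ) (x : Pixel ζ) :
    sphereRestrict ζ p x = eval (fun i => (x : EuclideanSpace ℝ (Fin ζ)) i) p := rfl

theorem sphereRestrict_mem_harmonicSpace {ζ k : ℕ} {p : MvPolynomial (Fin ζ) ℝ}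
    (hp : p.IsHomogeneous k) (hΔ : laplacian p = 0) :
    sphereRestrict ζ p ∈ harmonicSpace ζ k :=
  ⟨p, hp, by rwa [← laplacian_apply], fun _ => rfl⟩

theorem sphereRestrict_mem_iSup_of_isHomogeneous {ζ : ℕ} (hζ : ζ ≠ 0) (k : ℕ) :
    ∀ p : MvPolynomial (Fin ζ) ℝ, p.IsHomogeneous k →
      sphereRestrict ζ p ∈ ⨆ j, harmonicSpace ζ j := by
  have : Nonempty (Fin ζ) := ⟨⟨0, Nat.pos_of_ne_zero hζ⟩⟩
  induction k using Nat.twoStepInduction with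
  | zero =>
    exact fun p hp => Submodule.mem_iSup_of_mem 0 (sphereRestrict_mem_harmonicSpace hp
      (laplacian_eq_zero_of_lt_two hp (by norm_num)))
  | one =>
    exact fun p hp => Submodule.mem_iSup_of_mem 1 (sphereRestrict_mem_harmonicSpace hp
      (laplacian_eq_zero_of_lt_two hp (by norm_num)))
  | more k ih _ =>
    intro p hp
    obtain ⟨h, q, hh, hΔ, hq, rfl⟩ := exists_harmonic_add_normSqPoly_mul hp
    rw [map_add]
    refine add_mem (Submodule.mem_iSup_of_mem (k + 2) (sphereRestrict_mem_harmonicSpace hh hΔ)) ?_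
    -- On the sphere the factor `|X|²` equals `1`, so the remainder has dropped two degrees.
    convert ih q hq using 1
    ext x
    simp [sphereRestrict_apply, normSqPoly, sum_sq_eq_one]

theorem sphereRestrict_mem_iSup {ζ : ℕ} (hζ : ζ ≠ 0) (p : MvPolynomial (Fin ζ) ℝ) :
    sphereRestrict ζ p ∈ ⨆ j, harmonicSpace ζ j := by
  rw [← sum_homogeneousComponent p, map_sum]
  exact sum_mem fun k _ => sphereRestrict_mem_iSup_of_isHomogeneous hζ k _
    (homogeneousComponent_isHomogeneous k p)

/-! ### Nonzero harmonics of every frequency -/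

/-- The real and imaginary parts of `(X i + √-1 X j) ^ k`. -/
noncomputable def planarHarmonic {σ : Type*} (i j : σ) : ℕ → MvPolynomial σ ℝ × MvPolynomial σ ℝ
  | 0 => (1, 0)
  | k + 1 => (X i * (planarHarmonic i j k).1 - X j * (planarHarmonic i j k).2,
      X i * (planarHarmonic i j k).2 + X j * (planarHarmonic i j k).1)

theorem isHomogeneous_planarHarmonic {σ : Type*} (i j : σ) (k : ℕ) :
    (planarHarmonic i j k).1.IsHomogeneous k ∧ (planarHarmonic i j k).2.IsHomogeneous k := by
  induction k with
  | zero => exact ⟨isHomogeneous_one _ _, isHomogeneous_zero _ _ _⟩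
  | succ k ih =>
    simp only [planarHarmonic]
    rw [add_comm k 1]
    exact ⟨((isHomogeneous_X ℝ i).mul ih.1).sub ((isHomogeneous_X ℝ j).mul ih.2),
      ((isHomogeneous_X ℝ i).mul ih.2).add ((isHomogeneous_X ℝ j).mul ih.1)⟩

/-- Cauchy–Riemann equations for `(X i + √-1 X j)^(k+1)`; differentiating twice, they give
harmonicity. -/
theorem pderiv_planarHarmonic {σ : Type*} {i j : σ} (hij : i ≠ j) (k : ℕ) :
    pderiv i (planarHarmonic i j (k + 1)).1 = (k + 1 : ℝ) • (planarHarmonic i j k).1 ∧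
    pderiv i (planarHarmonic i j (k + 1)).2 = (k + 1 : ℝ) • (planarHarmonic i j k).2 ∧
    pderiv j (planarHarmonic i j (k + 1)).1 = -((k + 1 : ℝ) • (planarHarmonic i j k).2) ∧
    pderiv j (planarHarmonic i j (k + 1)).2 = (k + 1 : ℝ) • (planarHarmonic i j k).1 := by
  induction k with
  | zero => simp [planarHarmonic, pderiv_X_of_ne hij, pderiv_X_of_ne hij.symm]
  | succ k ih =>
    obtain ⟨h1, h2, h3, h4⟩ := ih
    rw [planarHarmonic]
    simp only [map_sub, map_add, pderiv_mul, h1, h2, h3, h4, pderiv_X_self, pderiv_X_of_ne hij,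
      pderiv_X_of_ne hij.symm]
    rw [planarHarmonic]
    simp only [smul_eq_C_mul, map_add, map_natCast, map_one]
    push_cast
    refine ⟨?_, ?_, ?_, ?_⟩ <;> ring

theorem pderiv_planarHarmonic_of_ne {σ : Type*} {i j l : σ} (hi : i ≠ l) (hj : j ≠ l) (k : ℕ) :
    pderiv l (planarHarmonic i j k).1 = 0 ∧ pderiv l (planarHarmonic i j k).2 = 0 := by
  induction k with
  | zero => simp [planarHarmonic]
  | succ k ih => simp [planarHarmonic, ih.1, ih.2, pderiv_X_of_ne hi, pderiv_X_of_ne hj]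

theorem laplacian_planarHarmonic {i j : ι} (hij : i ≠ j) (k : ℕ) :
    laplacian (planarHarmonic i j k).1 = 0 := by
  rcases lt_or_ge k 2 with hk | hk
  · exact laplacian_eq_zero_of_lt_two (isHomogeneous_planarHarmonic i j k).1 hk
  · obtain ⟨k, rfl⟩ := Nat.exists_eq_add_of_le' hk
    rw [laplacian_apply, Fintype.sum_eq_add i j hij]
    · obtain ⟨h1, -, h3, -⟩ := pderiv_planarHarmonic hij (k + 1)
      obtain ⟨h1', -, -, h4'⟩ := pderiv_planarHarmonic hij k
      rw [h1, h3, map_neg, Derivation.map_smul, Derivation.map_smul, h1', h4']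
      simp
    · intro l hl
      rw [(pderiv_planarHarmonic_of_ne hl.1.symm hl.2.symm (k + 2)).1, map_zero]

theorem eval_planarHarmonic {σ : Type*} {i j : σ} {x : σ → ℝ} (hi : x i = 1) (hj : x j = 0)
    (k : ℕ) : eval x (planarHarmonic i j k).1 = 1 ∧ eval x (planarHarmonic i j k).2 = 0 := by
  induction k with
  | zero => simp [planarHarmonic]
  | succ k ih => simp [planarHarmonic, ih.1, ih.2, hi, hj]

theorem exists_sphericalHarmonic_ne_zero {ζ : ℕ} (hζ : 2 ≤ ζ) (k : ℕ) :
    ∃ Y : Pixel ζ → ℝ, IsSphericalHarmonic k Y ∧ ∃ x, Y x ≠ 0 := by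
  let i : Fin ζ := ⟨0, by omega⟩
  let j : Fin ζ := ⟨1, by omega⟩
  have hij : i ≠ j := by simp [i, j]
  refine ⟨_, sphereRestrict_mem_harmonicSpace (isHomogeneous_planarHarmonic i j k).1
    (laplacian_planarHarmonic hij k), ⟨EuclideanSpace.single i 1, by simp⟩, ?_⟩
  rw [sphereRestrict_apply, (eval_planarHarmonic _ _ k).1]
  · exact one_ne_zero
  · simp
  · simp [hij.symm]

end Harmonic

end MultiDot

namespace MultiDot

/-! ### The multisphere -/

instance instIsFiniteMeasureSurfaceMeasure (m : ℕ) : IsFiniteMeasure (surfaceMeasure m) := by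
  unfold surfaceMeasure
  infer_instance

instance instIsOpenPosMeasureSurfaceMeasure (m : ℕ) :
    (surfaceMeasure m).IsOpenPosMeasure := by
  unfold surfaceMeasure
  infer_instance

instance instIsFiniteMeasureMultiMeasure (ζ d : ℕ) : IsFiniteMeasure (multiMeasure ζ d) := by
  unfold multiMeasure
  infer_instance

instance instIsOpenPosMeasureMultiMeasure (ζ d : ℕ) :
    (multiMeasure ζ d).IsOpenPosMeasure :=
  Measure.pi.isOpenPosMeasure _

variable {ζ d : ℕ}

theorem integrable_of_continuous {f : Multisphere ζ d → ℝ} (hf : Continuous f) :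
    Integrable f (multiMeasure ζ d) := by
  rw [← integrableOn_univ]
  exact hf.continuousOn.integrableOn_compact isCompact_univ

theorem pixelDots_mem_Icc (x z : Multisphere ζ d) (i : Fin d) :
    pixelDots x z i ∈ Set.Icc (-1 : ℝ) 1 := by
  have h := abs_real_inner_le_norm (x i : EuclideanSpace ℝ (Fin ζ)) (z i)
  simp only [norm_eq_of_mem_sphere, mul_one] at h
  exact abs_le.mp h

theorem continuous_pixelDots :
    Continuous fun p : Multisphere ζ d × Multisphere ζ d => pixelDots p.1 p.2 := by
  unfold pixelDots
  fun_prop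

theorem pixelDots_comm (x z : Multisphere ζ d) : pixelDots x z = pixelDots z x :=
  funext fun _ => real_inner_comm _ _

/-- Evaluate at `t = (1, …, 1)`; unconditional summability of reals is absolute. -/
theorem HasPowerSeriesOnCube.summable_abs {κ : (Fin d → ℝ) → ℝ} {b : (Fin d → ℕ) → ℝ}
    (hκ : HasPowerSeriesOnCube κ b) : Summable fun n => |b n| := by
  have h := (hκ (fun _ => 1) fun _ => by simp).summable
  simpa using h.abs

theorem abs_coeff_mul_prod_pow_le (c : ℝ) (n : Fin d → ℕ) {t : Fin d → ℝ}
    (ht : ∀ i, t i ∈ Set.Icc (-1 : ℝ) 1) : |c * ∏ i, t i ^ n i| ≤ |c| := by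
  rw [abs_mul, Finset.abs_prod]
  refine mul_le_of_le_one_right (abs_nonneg c) (Finset.prod_le_one (fun _ _ => abs_nonneg _) ?_)
  intro i _
  rw [abs_pow]
  exact pow_le_one₀ (abs_nonneg _) (abs_le.mpr (ht i))

theorem continuous_kernel {K : Multisphere ζ d → Multisphere ζ d → ℝ} {κ : (Fin d → ℝ) → ℝ}
    {b : (Fin d → ℕ) → ℝ} (hK : IsMultiDotProduct K κ) (hκ : HasPowerSeriesOnCube κ b) :
    Continuous fun p : Multisphere ζ d × Multisphere ζ d => K p.1 p.2 := by
  have h : (fun p : Multisphere ζ d × Multisphere ζ d => K p.1 p.2) =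
      fun p => ∑' n, b n * ∏ i, pixelDots p.1 p.2 i ^ n i :=
    funext fun p => by rw [hK, (hκ _ (pixelDots_mem_Icc p.1 p.2)).tsum_eq]
  rw [h]
  refine continuous_tsum (fun n => ?_) hκ.summable_abs
    fun n p => abs_coeff_mul_prod_pow_le _ _ (pixelDots_mem_Icc p.1 p.2)
  have hc := fun i => (continuous_apply i).comp (continuous_pixelDots (ζ := ζ) (d := d))
  exact continuous_const.mul (continuous_finsetProd _ fun i _ => (hc i).pow _)

theorem continuous_sphereRestrict (p : MvPolynomial (Fin ζ) ℝ) :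
    Continuous (sphereRestrict ζ p) :=
  (MvPolynomial.continuous_eval p).comp (by fun_prop)

theorem IsSphericalHarmonic.continuous {k : ℕ} {Y : Pixel ζ → ℝ} (hY : IsSphericalHarmonic k Y) :
    Continuous Y := by
  obtain ⟨p, -, -, hp⟩ := hY
  rw [show Y = sphereRestrict ζ p from funext hp]
  exact continuous_sphereRestrict p

theorem IsSHProduct.continuous {k : Fin d → ℕ} {Y : Multisphere ζ d → ℝ}
    (hY : IsSHProduct k Y) : Continuous Y := by
  obtain ⟨y, hy, hYy⟩ := hY
  rw [show Y = fun x => ∏ i, y i (x i) from funext hYy]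
  exact continuous_finsetProd _ fun i _ => (hy i).continuous.comp (continuous_apply i)

theorem exists_isSHProduct_ne_zero (hζ : 2 ≤ ζ) (k : Fin d → ℕ) :
    ∃ Y : Multisphere ζ d → ℝ, IsSHProduct k Y ∧ ∃ x, Y x ≠ 0 := by
  choose y hy x hx using fun i => exists_sphericalHarmonic_ne_zero hζ (k i)
  exact ⟨fun z => ∏ i, y i (z i), ⟨y, hy, fun _ => rfl⟩, x,
    Finset.prod_ne_zero_iff.mpr fun i _ => hx i⟩

/-! ### The eigenvalue of frequency `k` -/

/-- Termwise integration is dominated by `|b n| ∫ |Y|`, and Fubini splits each term into one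
Funk–Hecke integral per pixel. -/
theorem hasSum_kernelOp (hζ : 2 ≤ ζ) {K : Multisphere ζ d → Multisphere ζ d → ℝ}
    {κ : (Fin d → ℝ) → ℝ} {b : (Fin d → ℕ) → ℝ} (hK : IsMultiDotProduct K κ)
    (hκ : HasPowerSeriesOnCube κ b) {k : Fin d → ℕ} {Y : Multisphere ζ d → ℝ}
    (hY : IsSHProduct k Y) (x : Multisphere ζ d) :
    HasSum (fun n : Fin d → ℕ =>
      (b n * ∏ i, monomialEigenvalue ζ (k i) (n i)) * (sphereArea (ζ - 1) ^ d * Y x))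
      (kernelOp K Y x) := by
  have hYc := hY.continuous
  have hterm : ∀ n : Fin d → ℕ,
      Continuous fun z => b n * (∏ i, pixelDots x z i ^ n i) * Y z := fun n => by
    have hc := fun i => (continuous_apply i).comp
      ((continuous_pixelDots (ζ := ζ) (d := d)).comp (by fun_prop : Continuous fun z => (x, z)))
    exact (continuous_const.mul (continuous_finsetProd _ fun i _ => (hc i).pow _)).mul hYc
  have h := hasSum_integral_of_summable_integral_norm (μ := multiMeasure ζ d)
    (F := fun (n : Fin d → ℕ) z => b n * (∏ i, pixelDots x z i ^ n i) * Y z)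
    (fun n => integrable_of_continuous (hterm n)) (by
      refine Summable.of_nonneg_of_le (fun n => integral_nonneg fun _ => norm_nonneg _)
        (fun n => ?_) (hκ.summable_abs.mul_right (∫ z, |Y z| ∂multiMeasure ζ d))
      rw [← integral_const_mul]
      refine integral_mono (integrable_of_continuous (hterm n).norm)
        (integrable_of_continuous (continuous_const.mul hYc.abs)) fun z => ?_
      simp only [Real.norm_eq_abs]
      rw [abs_mul]
      exact mul_le_mul_of_nonneg_right
        (abs_coeff_mul_prod_pow_le _ _ (pixelDots_mem_Icc x z)) (abs_nonneg _))
  have e : ∫ z, ∑' n : Fin d → ℕ, b n * (∏ i, pixelDots x z i ^ n i) * Y z ∂multiMeasure ζ d =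
      kernelOp K Y x := by
    refine integral_congr_ae (.of_forall fun z => ?_)
    simp only [hK x z]
    exact ((hκ _ (pixelDots_mem_Icc x z)).mul_right (Y z)).tsum_eq
  rw [e] at h
  obtain ⟨y, hy, hYy⟩ := hY
  refine h.congr_fun fun n => ?_
  have e2 : ∀ z, b n * (∏ i, pixelDots x z i ^ n i) * Y z =
      b n * ∏ i, (inner ℝ (x i : EuclideanSpace ℝ (Fin ζ)) (z i : EuclideanSpace ℝ (Fin ζ)) ^ n i *
        y i (z i)) := fun z => by
    rw [hYy, Finset.prod_mul_distrib, mul_assoc]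
    rfl
  simp only [e2]
  rw [integral_const_mul, multiMeasure, integral_fintype_prod_eq_prod
    (f := fun i (w : Pixel ζ) => inner ℝ (x i : EuclideanSpace ℝ (Fin ζ))
      (w : EuclideanSpace ℝ (Fin ζ)) ^ n i * y i w),
    Finset.prod_congr rfl fun i _ => integral_inner_pow_mul_sphericalHarmonic hζ (hy i) (n i) (x i),
    Finset.prod_mul_distrib, Finset.prod_mul_distrib, hYy, Finset.prod_const, Finset.card_univ,
    Fintype.card_fin]
  ring

theorem sphereArea_pos {m : ℕ} (hm : m ≠ 0) : 0 < sphereArea m := by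
  have := Real.Gamma_pos_of_pos (show (0 : ℝ) < (m : ℝ) / 2 by positivity)
  rw [sphereArea_eq hm]
  positivity

theorem injective_add_two_mul (k : Fin d → ℕ) :
    Function.Injective fun s : Fin d → ℕ => fun i => k i + 2 * s i := by
  intro s s' h
  ext i
  have := congrFun h i
  dsimp only at this
  omega

theorem prod_monomialEigenvalue_eq_zero (hζ : 2 ≤ ζ) {k n : Fin d → ℕ}
    (hn : n ∉ Set.range fun s : Fin d → ℕ => fun i => k i + 2 * s i) :
    ∏ i, monomialEigenvalue ζ (k i) (n i) = 0 := by
  by_contra h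
  refine hn ?_
  have h' : ∀ i, ∃ m, n i = k i + 2 * m := by
    intro i
    by_contra hi
    push Not at hi
    exact h (Finset.prod_eq_zero (Finset.mem_univ i) (monomialEigenvalue_eq_zero hζ hi))
  choose s hs using h'
  exact ⟨s, (funext hs).symm⟩

/-- Take the expansion at a point where `Y ≠ 0`, cancel the constant, and restrict to the indices `k
+ 2s`. -/
theorem summable_eigenTerm (hζ : 2 ≤ ζ) {K : Multisphere ζ d → Multisphere ζ d → ℝ}
    {κ : (Fin d → ℝ) → ℝ} {b : (Fin d → ℕ) → ℝ} (hK : IsMultiDotProduct K κ)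
    (hκ : HasPowerSeriesOnCube κ b) (k : Fin d → ℕ) : Summable (eigenTerm ζ b k) := by
  obtain ⟨Y, hY, x, hx⟩ := exists_isSHProduct_ne_zero hζ k
  have h := (hasSum_kernelOp hζ hK hκ hY x).summable
  rw [summable_mul_right_iff
    (mul_ne_zero (pow_ne_zero _ (sphereArea_pos (by omega)).ne') hx)] at h
  exact h.comp_injective (injective_add_two_mul k)

theorem kernelOp_eq (hζ : 2 ≤ ζ) {K : Multisphere ζ d → Multisphere ζ d → ℝ}
    {κ : (Fin d → ℝ) → ℝ} {b : (Fin d → ℕ) → ℝ} (hK : IsMultiDotProduct K κ)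
    (hκ : HasPowerSeriesOnCube κ b) {k : Fin d → ℕ} {Y : Multisphere ζ d → ℝ}
    (hY : IsSHProduct k Y) (x : Multisphere ζ d) :
    kernelOp K Y x = seriesEigenvalue ζ b k * Y x := by
  have h := hasSum_kernelOp hζ hK hκ hY x
  rw [← (injective_add_two_mul k).hasSum_iff] at h
  · have h' := (summable_eigenTerm hζ hK hκ k).hasSum.mul_right (sphereArea (ζ - 1) ^ d * Y x)
    rw [h.unique h', seriesEigenvalue]
    ring
  · intro n hn
    rw [prod_monomialEigenvalue_eq_zero hζ hn]
    simp

theorem isEigenvalueAt_iff (hζ : 2 ≤ ζ) {K : Multisphere ζ d → Multisphere ζ d → ℝ}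
    {κ : (Fin d → ℝ) → ℝ} {b : (Fin d → ℕ) → ℝ} (hK : IsMultiDotProduct K κ)
    (hκ : HasPowerSeriesOnCube κ b) (k : Fin d → ℕ) (μ : ℝ) :
    IsEigenvalueAt K k μ ↔ μ = seriesEigenvalue ζ b k := by
  constructor
  · intro h
    obtain ⟨Y, hY, x, hx⟩ := exists_isSHProduct_ne_zero hζ k
    exact mul_right_cancel₀ hx ((h Y hY x).symm.trans (kernelOp_eq hζ hK hκ hY x))
  · rintro rfl Y hY x
    exact kernelOp_eq hζ hK hκ hY x

/-! ### Completeness of the products of spherical harmonics -/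

theorem integrable_mul_of_continuous {f g : Multisphere ζ d → ℝ}
    (hf : Integrable f (multiMeasure ζ d)) (hg : Continuous g) :
    Integrable (fun z => f z * g z) (multiMeasure ζ d) := by
  obtain ⟨C, hC⟩ := isCompact_univ.exists_bound_of_continuousOn hg.continuousOn
  exact hf.mul_bdd hg.aestronglyMeasurable (.of_forall fun z => hC z (Set.mem_univ z))

/-- The coordinates of a point of the multisphere. -/
def coords (z : Multisphere ζ d) (p : Fin d × Fin ζ) : ℝ :=
  (z p.1 : EuclideanSpace ℝ (Fin ζ)) p.2

theorem continuous_coords : Continuous (coords : Multisphere ζ d → Fin d × Fin ζ → ℝ) := by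
  unfold coords
  fun_prop

/-- Each factor is a finite sum of harmonics; multiplying out gives a finite sum of products of
harmonics. -/
theorem integral_mul_prod_sphereRestrict_eq_zero (hζ : ζ ≠ 0) {f : Multisphere ζ d → ℝ}
    (hf : Integrable f (multiMeasure ζ d))
    (h0 : ∀ (k : Fin d → ℕ) (Y : Multisphere ζ d → ℝ), IsSHProduct k Y →
      ∫ z, f z * Y z ∂multiMeasure ζ d = 0) (p : Fin d → MvPolynomial (Fin ζ) ℝ) :
    ∫ z, f z * ∏ i, sphereRestrict ζ (p i) (z i) ∂multiMeasure ζ d = 0 := by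
  choose F hF hFp using fun i =>
    (Submodule.mem_iSup_iff_exists_finsupp _ _).mp (sphereRestrict_mem_iSup hζ (p i))
  have hsum : ∀ z : Multisphere ζ d, f z * ∏ i, sphereRestrict ζ (p i) (z i) =
      ∑ k ∈ Fintype.piFinset fun i => (F i).support, f z * ∏ i, F i (k i) (z i) := by
    intro z
    rw [← Finset.mul_sum, ← Finset.prod_univ_sum (fun i => (F i).support)
      (fun i j => F i j (z i))]
    congr 1
    refine Finset.prod_congr rfl fun i _ => ?_
    rw [← hFp i, Finsupp.sum, Finset.sum_apply]
  have hSH : ∀ k : Fin d → ℕ, IsSHProduct k fun z : Multisphere ζ d => ∏ i, F i (k i) (z i) :=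
    fun k => ⟨fun i => F i (k i), fun i => hF i (k i), fun _ => rfl⟩
  simp only [hsum]
  rw [integral_finsetSum _ fun k _ => integrable_mul_of_continuous hf (hSH k).continuous]
  exact Finset.sum_eq_zero fun k _ => h0 k _ (hSH k)

theorem integral_mul_eval_coords_eq_zero (hζ : ζ ≠ 0) {f : Multisphere ζ d → ℝ}
    (hf : Integrable f (multiMeasure ζ d))
    (h0 : ∀ (k : Fin d → ℕ) (Y : Multisphere ζ d → ℝ), IsSHProduct k Y →
      ∫ z, f z * Y z ∂multiMeasure ζ d = 0) (P : MvPolynomial (Fin d × Fin ζ) ℝ) :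
    ∫ z, f z * MvPolynomial.eval (coords z) P ∂multiMeasure ζ d = 0 := by
  induction P using MvPolynomial.induction_on' with
  | add p q hp hq =>
    simp only [map_add, mul_add]
    rw [integral_add, hp, hq, add_zero] <;>
    exact integrable_mul_of_continuous hf
      ((MvPolynomial.continuous_eval _).comp continuous_coords)
  | monomial s c =>
    have h := integral_mul_prod_sphereRestrict_eq_zero hζ hf h0
      fun i => ∏ a, MvPolynomial.X a ^ s (i, a)
    have e : ∀ z : Multisphere ζ d, f z * MvPolynomial.eval (coords z)
        (MvPolynomial.monomial s c) = c * (f z *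
          ∏ i, sphereRestrict ζ (∏ a, MvPolynomial.X a ^ s (i, a)) (z i)) := by
      intro z
      rw [MvPolynomial.eval_monomial, Finsupp.prod_fintype _ _ (by simp), Fintype.prod_prod_type]
      simp only [sphereRestrict_apply, map_prod, map_pow, MvPolynomial.eval_X, coords]
      ring
    simp only [e]
    rw [integral_const_mul, h, mul_zero]

/-- The coordinate functions of the multisphere, as continuous maps. -/
def coordMap (ζ d : ℕ) (p : Fin d × Fin ζ) : C(Multisphere ζ d, ℝ) :=
  ⟨fun z => coords z p, (continuous_apply p).comp continuous_coords⟩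

theorem aeval_coordMap_apply (P : MvPolynomial (Fin d × Fin ζ) ℝ) (z : Multisphere ζ d) :
    MvPolynomial.aeval (coordMap ζ d) P z = MvPolynomial.eval (coords z) P := by
  induction P using MvPolynomial.induction_on with
  | C a => simp
  | add p q hp hq => simp [hp, hq]
  | mul_X p i hp => simp [hp, coordMap]

theorem dense_range_aeval_coordMap :
    Dense ((MvPolynomial.aeval (R := ℝ) (coordMap ζ d)).range : Set C(Multisphere ζ d, ℝ)) := by
  have h := ContinuousMap.subalgebra_topologicalClosure_eq_top_of_separatesPoints
    (MvPolynomial.aeval (R := ℝ) (coordMap ζ d)).range ?_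
  · rw [dense_iff_closure_eq, ← Subalgebra.topologicalClosure_coe, h]
    rfl
  · intro x y hxy
    have : ∃ i a, (x i : EuclideanSpace ℝ (Fin ζ)) a ≠ (y i : EuclideanSpace ℝ (Fin ζ)) a := by
      by_contra! h
      exact hxy (funext fun i => Subtype.ext (PiLp.ext (h i)))
    obtain ⟨i, a, hia⟩ := this
    exact ⟨_, ⟨coordMap ζ d (i, a), ⟨MvPolynomial.X (i, a), by simp⟩, rfl⟩, hia⟩

theorem ae_eq_zero_of_forall_integral_mul_isSHProduct_eq_zero (hζ : ζ ≠ 0)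
    {f : Multisphere ζ d → ℝ} (hf : MemLp f 2 (multiMeasure ζ d))
    (h0 : ∀ (k : Fin d → ℕ) (Y : Multisphere ζ d → ℝ), IsSHProduct k Y →
      ∫ z, f z * Y z ∂multiMeasure ζ d = 0) : f =ᵐ[multiMeasure ζ d] 0 := by
  have hdense : Dense (ContinuousMap.toLp (E := ℝ) 2 (multiMeasure ζ d) ℝ ''
      ((MvPolynomial.aeval (R := ℝ) (coordMap ζ d)).range : Set C(Multisphere ζ d, ℝ))) :=
    (ContinuousMap.toLp_denseRange ℝ (multiMeasure ζ d) ℝ (by norm_num)).dense_image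
      (ContinuousLinearMap.continuous _) dense_range_aeval_coordMap
  have hz : hf.toLp f = 0 := by
    refine hdense.eq_zero_of_inner_left ℝ fun v hv => ?_
    obtain ⟨_, ⟨P, rfl⟩, rfl⟩ := hv
    rw [L2.inner_def, ← integral_mul_eval_coords_eq_zero hζ (hf.integrable (by norm_num)) h0 P]
    refine integral_congr_ae ?_
    filter_upwards [hf.coeFn_toLp, ContinuousMap.coeFn_toLp (p := 2) (𝕜 := ℝ) (multiMeasure ζ d)
      (MvPolynomial.aeval (coordMap ζ d) P)] with z h1 h2
    rw [h1, ← aeval_coordMap_apply, ← h2, mul_comm]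
    rfl
  filter_upwards [hf.coeFn_toLp, Lp.coeFn_zero ℝ 2 (multiMeasure ζ d)] with z h1 h2
  rw [← h1, hz, h2]

/-! ### The spectrum of the integral operator -/

/-- Self-adjointness by Fubini: `K` and `Y` are continuous on compact spaces, hence bounded, so
integrability of `f` suffices. -/
theorem integral_kernelOp_mul {K : Multisphere ζ d → Multisphere ζ d → ℝ}
    (hKc : Continuous fun p : Multisphere ζ d × Multisphere ζ d => K p.1 p.2)
    (hKs : ∀ x z, K x z = K z x) {f Y : Multisphere ζ d → ℝ}
    (hf : Integrable f (multiMeasure ζ d)) (hY : Continuous Y) :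
    ∫ x, kernelOp K f x * Y x ∂multiMeasure ζ d =
      ∫ z, f z * kernelOp K Y z ∂multiMeasure ζ d := by
  obtain ⟨C, hC⟩ := isCompact_univ.exists_bound_of_continuousOn hKc.continuousOn
  have hint : Integrable (Function.uncurry fun x z => K x z * (Y x * f z))
      ((multiMeasure ζ d).prod (multiMeasure ζ d)) :=
    ((integrable_of_continuous hY).mul_prod hf).bdd_mul hKc.aestronglyMeasurable
      (.of_forall fun p => hC p (Set.mem_univ p))
  calc ∫ x, kernelOp K f x * Y x ∂multiMeasure ζ d
      = ∫ x, ∫ z, K x z * (Y x * f z) ∂multiMeasure ζ d ∂multiMeasure ζ d := by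
        refine integral_congr_ae (.of_forall fun x => ?_)
        simp only [kernelOp]
        rw [← integral_mul_const]
        exact integral_congr_ae (.of_forall fun z => by simp only; ring)
    _ = ∫ z, ∫ x, K x z * (Y x * f z) ∂multiMeasure ζ d ∂multiMeasure ζ d :=
        integral_integral_swap hint
    _ = ∫ z, f z * kernelOp K Y z ∂multiMeasure ζ d := by
        refine integral_congr_ae (.of_forall fun z => ?_)
        simp only [kernelOp]
        rw [← integral_const_mul]
        exact integral_congr_ae (.of_forall fun x => by simp only [hKs x z]; ring)

theorem isKernelEigenvalue_iff (hζ : 2 ≤ ζ) {K : Multisphere ζ d → Multisphere ζ d → ℝ}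
    {κ : (Fin d → ℝ) → ℝ} {b : (Fin d → ℕ) → ℝ} (hK : IsMultiDotProduct K κ)
    (hκ : HasPowerSeriesOnCube κ b) (μ : ℝ) :
    IsKernelEigenvalue K μ ↔ ∃ k : Fin d → ℕ, μ = seriesEigenvalue ζ b k := by
  constructor
  · rintro ⟨f, hf, hf0, hfμ⟩
    have : ∃ (k : Fin d → ℕ) (Y : Multisphere ζ d → ℝ), IsSHProduct k Y ∧
        ∫ z, f z * Y z ∂multiMeasure ζ d ≠ 0 := by
      by_contra! h
      exact hf0 (ae_eq_zero_of_forall_integral_mul_isSHProduct_eq_zero (by omega) hf h)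
    obtain ⟨k, Y, hY, hne⟩ := this
    refine ⟨k, mul_right_cancel₀ hne ?_⟩
    have h := integral_kernelOp_mul (continuous_kernel hK hκ)
      (fun x z => by rw [hK, hK, pixelDots_comm]) (hf.integrable (by norm_num)) hY.continuous
    calc μ * ∫ z, f z * Y z ∂multiMeasure ζ d
        = ∫ x, kernelOp K f x * Y x ∂multiMeasure ζ d := by
          rw [← integral_const_mul]
          refine integral_congr_ae ?_
          filter_upwards [hfμ] with x hx
          rw [hx]
          ring
      _ = seriesEigenvalue ζ b k * ∫ z, f z * Y z ∂multiMeasure ζ d := by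
          rw [h, ← integral_const_mul]
          refine integral_congr_ae (.of_forall fun z => ?_)
          simp only [kernelOp_eq hζ hK hκ hY]
          ring
  · rintro ⟨k, rfl⟩
    obtain ⟨Y, hY, x, hx⟩ := exists_isSHProduct_ne_zero hζ k
    obtain ⟨C, hC⟩ := isCompact_univ.exists_bound_of_continuousOn hY.continuous.continuousOn
    refine ⟨Y, .of_bound hY.continuous.aestronglyMeasurable C
      (.of_forall fun z => hC z (Set.mem_univ z)), fun h => hx ?_,
      .of_forall (kernelOp_eq hζ hK hκ hY)⟩
    -- The measure charges nonempty open sets, so a continuous function vanishing almost everywhere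
    -- vanishes identically.
    exact congrFun (hY.continuous.ae_eq_iff_eq _ continuous_zero |>.mp h) x

end MultiDot

theorem mainTheorem6 (ζ d : ℕ) (hζ : 2 ≤ ζ)
    (K : MultiDot.Multisphere ζ d → MultiDot.Multisphere ζ d → ℝ)
    (κ : (Fin d → ℝ) → ℝ) (b : (Fin d → ℕ) → ℝ)
    (hK : MultiDot.IsMultiDotProduct K κ) (hκ : MultiDot.HasPowerSeriesOnCube κ b) :
    (∀ k n : ℕ, MultiDot.monomialEigenvalue ζ k n =
      if k ≤ n ∧ Even (n - k) then
        (n.factorial : ℝ) / (((n - k).factorial : ℝ) * 2 ^ k) *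
          (Real.Gamma (((ζ : ℝ) - 1) / 2) * Real.Gamma (((n : ℝ) - k + 1) / 2) /
            Real.Gamma (((n : ℝ) + k + ζ) / 2))
      else 0) ∧
    (∀ k : Fin d → ℕ, Summable (MultiDot.eigenTerm ζ b k) ∧
      ∀ μ : ℝ, MultiDot.IsEigenvalueAt K k μ ↔ μ = MultiDot.seriesEigenvalue ζ b k) ∧
    (∀ μ : ℝ, MultiDot.IsKernelEigenvalue K μ ↔
      ∃ k : Fin d → ℕ, μ = MultiDot.seriesEigenvalue ζ b k) :=
  ⟨MultiDot.monomialEigenvalue_eq_ite hζ,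
    fun k => ⟨MultiDot.summable_eigenTerm hζ hK hκ k, MultiDot.isEigenvalueAt_iff hζ hK hκ k⟩,
    MultiDot.isKernelEigenvalue_iff hζ hK hκ⟩
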